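/- Let $n\in\{4,5\}$, let $c\subset A_n$ be the set of 3-cycles, and let $S\to A_n$ be a Schur cover, i.e. a surjection of groups whose kernel is contained in the centre and in the commutator subgroup of $S$ and is isomorphic to $H_2(A_n,\mathbb{Z})$. Let $Q_c\subset S$ be the subgroup generated by the commutators $[\tilde x,\tilde y]$, where $\tilde x,\tilde y\in S$ lift commuting elements $x\in c$, $y\in A_n$. Let $\pi:\widetilde{A}_n=S/Q_c\to A_n$ be the induced map (the reduced Schur cover of $(A_n,c)$), with kernel $H_2(A_n,c,\mathbb{Z})=H_2(A_n,\mathbb{Z})/Q_c$. Then $H_2(A_n,c,\mathbb{Z})\cong\mathbb{Z}/2$, and $\pi$ maps the set $\tilde c$ of elements of order $3$ of $\widetilde{A}_n$ bijectively onto $c$. For $x\in c$ write $x^*$ for its preimage in $\tilde c$, and put $1^*=1$. Let $\rho:G_{\mathbb{Q}}=\mathrm{Gal}(\overline{\mathbb{Q}}/\mathbb{Q})\to A_n$ be a continuous surjective homomorphism which is trivial at the infinite place (it kills every complex conjugation), is tamely ramified, and maps each inertia group above each prime either to $1$ or onto the cyclic group generated by an element of $c$. Equivalently, the fixed field $L$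 of $\ker\rho$ is a totally real $A_n$ field all of whose ramification is of type $c$. A \emph{tame real lift} of $\rho$ is a continuous homomorphism $\tilde\rho:G_{\mathbb{Q}}\to\widetilde{A}_n$ with $\pi\circ\tilde\rho=\rho$ which is trivial at the infinite place and tamely ramified. For every prime $p$ choose a prime $\mathfrak{P}_p$ above $p$ of the ring of algebraic integers in $\overline{\mathbb{Q}}$, with inertia group $I_p\subset G_{\mathbb{Q}}$, and an element $g_p\in I_p$ mapped to $-1$ by the tame character $I_p\to\mathbb{F}_p^\times$, $\sigma\mapsto \sigma(\varpi)/\varpi \bmod \mathfrak{P}_p$, where $\varpi^{p-1}=a$ with $a\in p\mathbb{Z}\setminus p^2\mathbb{Z}$. The invariant of $\rho$ is $$\mathfrak{z}(\rho)=\prod_{p}\tilde\rho(g_p)\,(\rho(g_p)^*)^{-1}\in H_2(A_n,c,\mathbb{Z}),$$ where $\tilde\rho$ is a tame real lift of $\rho$; all but finitely many factors are $1$. Let $\tilde\rho$ be a tame real lift of $\rho$ and let $\widetilde{L}$ be the fixed field of $\ker\tilde\rho$. Then the set of primes $p\equiv 3\pmod 4$ with even ramification index in $\widetilde{L}$ is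 finite, the invariant $\mathfrak{z}(\rho)$ is well defined (it does not depend on the choices of $\mathfrak{P}_p$, of $g_p$ and of the tame real lift used to compute it), and under the isomorphism $H_2(A_n,c,\mathbb{Z})\cong\mathbb{Z}/2$, $$\mathfrak{z}(\rho)=\#\{p\equiv 3 \pmod 4 : p \text{ has even ramification index in } \widetilde{L}\}\bmod 2 .$$ -/

import Mathlib

open scoped NumberField commutatorElement

noncomputable section

namespace SchurInvariant

/-! ### Schur covers and reduced Schur covers -/

section Groups

universe u

/-- A stem extension of `G`: a surjection `p : S → G` whose kernel is contained both in the centre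
and in the commutator subgroup of `S`. -/
def IsStemExtension {S : Type u} {G : Type} [Group S] [Group G] (p : S →* G) : Prop :=
  Function.Surjective p ∧ p.ker ≤ Subgroup.center S ⊓ commutator S

/-- A Schur cover of `G`: a stem extension of `G` with kernel isomorphic to `H₂(G, ℤ)`. -/
def IsSchurCover {S : Type u} {G : Type} [Group S] [Group G] (p : S →* G) : Prop :=
  IsStemExtension p ∧
    Nonempty (Additive p.ker ≃+ groupHomology (Rep.trivial ℤ G ℤ) 2)

/-- The subgroup `Q_c` generated by all commutators `⟨x, y⟩ = [x', y']`, where `x ∈ c` and `y ∈ G`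
commute and `x'`, `y'` are lifts of `x`, `y`. -/
def commutatorPairing {S : Type u} {G : Type} [Group S] [Group G] (p : S →* G) (c : Set G) :
    Subgroup S :=
  Subgroup.closure {z | ∃ x y : S, p x ∈ c ∧ Commute (p x) (p y) ∧ z = ⁅x, y⁆}

/-- `π : E → G` is a reduced Schur cover of `(G, c)`: it is the quotient of a Schur cover `S` of
`G` by `Q_c` (presented by a surjection `q : S → E` over `G` with kernel `Q_c`). The kernel of `π`
is then the reduced Schur multiplier `H₂(G, c, ℤ) = H₂(G, ℤ) / Q_c`. -/
def IsReducedSchurCover {E : Type u} {G : Type} [Group E] [Group G] (π : E →* G) (c : Set G) :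
    Prop :=
  ∃ (S : Type u) (_ : Group S) (p : S →* G) (q : S →* E),
    IsSchurCover p ∧ Function.Surjective q ∧ π.comp q = p ∧ q.ker = commutatorPairing p c

end Groups

/-- The set of 3-cycles in the alternating group `A_n`. -/
def threeCycles (n : ℕ) : Set (alternatingGroup (Fin n)) :=
  {x | (x : Equiv.Perm (Fin n)).IsThreeCycle}

/-! ### The absolute Galois group of `ℚ` -/

/-- The algebraic closure of `ℚ`. -/
abbrev QBar : Type := AlgebraicClosure ℚ

/-- The absolute Galois group of `ℚ`. -/
abbrev GalQ : Type := Gal(QBar/ℚ)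

/-- `P` is a prime of the ring of all algebraic integers lying above the rational prime `p`. Its
inertia group in `GalQ` is `P.inertia GalQ`. -/
def IsPrimeAbove (P : Ideal (𝓞 QBar)) (p : ℕ) : Prop :=
  P.IsPrime ∧ (p : 𝓞 QBar) ∈ P

section Representations

universe u v

variable {H : Type u} [Group H]

/-- `ρ` is trivial at the infinite places: it kills every complex conjugation, that is, every
`σ` that becomes complex conjugation under some embedding of the algebraic closure into `ℂ`. -/
def TrivialAtInfinity (ρ : GalQ →* H) : Prop :=
  ∀ (φ : QBar →+* ℂ) (σ : GalQ), (∀ x : QBar, φ (σ x) = starRingEnd ℂ (φ x)) → ρ σ = 1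

/-- `ρ` (with finite image) is tamely ramified: the image of every inertia group above `p` has
order prime to `p`. -/
def TamelyRamified (ρ : GalQ →* H) : Prop :=
  ∀ (p : ℕ) (P : Ideal (𝓞 QBar)), p.Prime → IsPrimeAbove P p →
    (Nat.card ((P.inertia GalQ).map ρ)).Coprime p

/-- All ramification of `ρ` is of type `c`: it is tamely ramified, and the image of every inertia
group is trivial or is a cyclic group generated by an element of `c`. -/
def RamificationOfType (ρ : GalQ →* H) (c : Set H) : Prop :=
  TamelyRamified ρ ∧
    ∀ (p : ℕ) (P : Ideal (𝓞 QBar)), p.Prime → IsPrimeAbove P p →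
      ∃ x ∈ insert 1 c, (P.inertia GalQ).map ρ = Subgroup.zpowers x

/-- `ρt` is a continuous lift of `ρ` along `π`, trivial at the infinite places and tamely ramified.
(The target is discrete, so continuity means that the kernel is open.) -/
def IsTameRealLift {G : Type v} [Group G] (π : H →* G) (ρ : GalQ →* G) (ρt : GalQ →* H) : Prop :=
  π.comp ρt = ρ ∧ IsOpen (ρt.ker : Set GalQ) ∧ TrivialAtInfinity ρt ∧ TamelyRamified ρt

/-- `g` lies in the inertia group of `P` (above `p`) and is mapped to `-1` by the tame character
`I_P → 𝔽_p^×`, `g ↦ g(ϖ) / ϖ mod P`, where `ϖ ^ (p - 1) = a` for some `a ∈ pℤ - p²ℤ`. -/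
def IsTameNegOne (p : ℕ) (P : Ideal (𝓞 QBar)) (g : GalQ) : Prop :=
  g ∈ P.inertia GalQ ∧
    ∃ (a : ℤ) (ϖ w : 𝓞 QBar), (p : ℤ) ∣ a ∧ ¬ (p : ℤ) ^ 2 ∣ a ∧ ϖ ^ (p - 1) = (a : 𝓞 QBar) ∧
      g • ϖ = w * ϖ ∧ w + 1 ∈ P

open scoped IsMulCommutative in
/-- `z` is a value of the invariant of `ρ : GalQ → G` with respect to `π : E → G` and the set
`ct ⊆ E` of distinguished lifts: for some tame lift `ρt` of `ρ` trivial at infinity, some choice of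
primes `P p` above all rational primes `p` and some `g p` in the inertia group of `P p` mapping to
`-1`, it is the product over all `p` of `ρt (g p) * (ρ (g p)^*)⁻¹`. Here `x^*` (called `s p` for
`x = ρ (g p)`) is the lift of `x` in `ct`, and `1^* = 1`. All but finitely many factors `f p` are
`1`, and the factors are central, so the product is formed in the centre of `E`. -/
def IsInvariant {G : Type v} [Group G] (π : H →* G) (ct : Set H) (ρ : GalQ →* G) (z : H) : Prop :=
  ∃ (ρt : GalQ →* H) (P : Nat.Primes → Ideal (𝓞 QBar)) (g : Nat.Primes → GalQ)
    (s : Nat.Primes → H) (f : Nat.Primes → Subgroup.center H),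
    IsTameRealLift π ρ ρt ∧
    (∀ p, IsPrimeAbove (P p) p ∧ IsTameNegOne p (P p) (g p)) ∧
    (∀ p, s p ∈ insert 1 ct ∧ π (s p) = ρ (g p)) ∧
    (∀ p, (f p : H) = ρt (g p) * (s p)⁻¹) ∧
    (Function.mulSupport f).Finite ∧
    z = ((∏ᶠ p, f p : Subgroup.center H) : H)

/-- The field cut out by `ρ`: the fixed field of its kernel. -/
abbrev fieldOf (ρ : GalQ →* H) : IntermediateField ℚ QBar :=
  IntermediateField.fixedField ρ.ker

end Representations

/-- The primes `p ≡ 3 mod 4` with even ramification index in the (Galois) number field `F`. -/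
def evenRamifiedThreeModFour (F : IntermediateField ℚ QBar) : Set ℕ :=
  {p | p.Prime ∧ p % 4 = 3 ∧ Even ((Ideal.span {(p : ℤ)}).ramificationIdxIn (𝓞 F))}

end SchurInvariant

end

open scoped NumberField commutatorElement

noncomputable section

/-! ### Inertia groups in an algebraic closure of `ℚ` -/

section Inertia

open scoped Pointwise

variable {Ω : Type*} [Field Ω] [CharZero Ω] [IsGalois ℚ Ω]
variable (K : Type*) [Field K] [NumberField K] [Algebra K Ω]

/-! The group theory reduces to a central extension by a group of order two. Transfer bounds the
kernel of a Schur cover of `A_4` or `A_5` by two elements, and a double cover made of matrices over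
`ZMod 5` shows that it is nontrivial. Since a 3-cycle generates its own centralizer in `A_n`, the
subgroup `Q_c` is trivial, so nothing is lost in the reduced cover
(`surjective_and_card_ker_of_isReducedSchurCover`).

If `s` is `1` or has order three and lies over the same element as `y`, then `y * s⁻¹ = y ^ 3`
(`mul_inv_eq_pow_three`). The local factor at `p` is therefore `ρt (g p) ^ 3`. On an inertia group
at `p` the map `σ ↦ ρt σ ^ 3` is a quadratic character, nontrivial exactly when the ramification
index is even. At `2` tameness makes it trivial. At odd `p` inertia has at most one nontrivial
quadratic character with open kernel (`map_eq_one_iff_of_quadratic_characters`), so it must be the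
one attached to the square root `ϖ ^ ((p - 1) / 2)` of `a`, whose value where the tame character is
`-1` is `(-1) ^ ((p - 1) / 2)`. So the factor is nontrivial if and only if `p ≡ 3 mod 4` and the
ramification index is even; this computation no longer sees the prime above `p` or the element
chosen.

Two tame real lifts differ by a quadratic character of the Galois group of `ℚ` that is real and
unramified at `2`. If nontrivial, it belongs to `√d` with `d` squarefree, `d > 0` and `d ≡ 1 mod 4`,
and such a `d` has an even number of prime factors `≡ 3 mod 4`. Passing to the other lift changes
exactly those local factors, so the parity is unaffected (`ncard_evenRamifiedThreeModFour_eq`). -/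

variable (Ω) in
theorem isFractionRing_ringOfIntegers_of_isGalois : IsFractionRing (𝓞 Ω) Ω := by
  have : Algebra.IsAlgebraic ℤ ℚ := IsLocalization.isAlgebraic ℚ (nonZeroDivisors ℤ)
  have : Algebra.IsAlgebraic ℤ Ω := Algebra.IsAlgebraic.trans ℤ ℚ Ω
  exact integralClosure.isFractionRing_of_algebraic fun x hx ↦ by simpa using hx

variable (Ω) in
theorem isGaloisGroup_ringOfIntegers_of_isGalois : IsGaloisGroup Gal(Ω/K) (𝓞 K) (𝓞 Ω) := by
  have := isFractionRing_ringOfIntegers_of_isGalois Ω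
  have : IsGalois K Ω := IsGalois.tower_top_of_isGalois ℚ K Ω
  exact IsGaloisGroup.of_isFractionRing _ _ _ K Ω

omit [CharZero Ω] [IsGalois ℚ Ω] in
theorem isOpen_stabilizer_ringOfIntegers {F : Type*} [Field F] [Algebra F Ω]
    [Algebra.IsAlgebraic F Ω] (x : 𝓞 Ω) :
    IsOpen (MulAction.stabilizer Gal(Ω/F) x : Set Gal(Ω/F)) := by
  convert stabilizer_isOpen_of_isIntegral (K := F) (x : Ω) using 1
  ext σ
  simp only [SetLike.mem_coe, MulAction.mem_stabilizer_iff]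
  exact NumberField.RingOfIntegers.ext_iff

omit [IsGalois ℚ Ω] in
theorem restrictNormal_coe_smul [IsGalois ℚ K] (σ : Gal(Ω/ℚ)) (x : 𝓞 K) :
    algebraMap (𝓞 K) (𝓞 Ω) (AlgEquiv.restrictNormalHom K σ • x) = σ • algebraMap (𝓞 K) (𝓞 Ω) x :=
  NumberField.RingOfIntegers.ext (AlgEquiv.restrictNormal_commutes σ K (x : K))

omit [IsGalois ℚ Ω] in
variable {K} in
theorem restrictNormal_mem_inertia [IsGalois ℚ K] (P : Ideal (𝓞 Ω)) {σ : Gal(Ω/ℚ)}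
    (hσ : σ ∈ P.inertia Gal(Ω/ℚ)) :
    AlgEquiv.restrictNormalHom K σ ∈ (P.under (𝓞 K)).inertia Gal(K/ℚ) := by
  intro x
  change _ ∈ P
  rw [map_sub, restrictNormal_coe_smul]
  exact hσ _

open Ideal.Quotient in
/-- Inertia groups of a number field lift to inertia groups of an algebraic closure. -/
theorem exists_inertia_restrictNormal_eq [IsGalois ℚ K] (P : Ideal (𝓞 Ω)) [P.IsPrime]
    {σ : Gal(K/ℚ)} (hσ : σ ∈ (P.under (𝓞 K)).inertia Gal(K/ℚ)) :
    ∃ τ ∈ P.inertia Gal(Ω/ℚ), AlgEquiv.restrictNormalHom K τ = σ := by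
  have : IsGalois K Ω := IsGalois.tower_top_of_isGalois ℚ K Ω
  have hG := isGaloisGroup_ringOfIntegers_of_isGalois Ω K
  have := hG.commutes
  have := hG.isInvariant
  -- The results for profinite groups used below ask for a continuous action on a discrete ring;
  -- continuity is openness of stabilizers.
  let : TopologicalSpace (𝓞 Ω) := ⊥
  have : DiscreteTopology (𝓞 Ω) := ⟨rfl⟩
  have : ContinuousSMul Gal(Ω/K) (𝓞 Ω) :=
    continuousSMul_iff_stabilizer_isOpen.mpr isOpen_stabilizer_ringOfIntegers
  let res : Gal(Ω/K) →* Gal(Ω/ℚ) :=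
    { toFun := fun ν ↦ ν.restrictScalars ℚ, map_one' := rfl, map_mul' := fun _ _ ↦ rfl }
  have hres (ν : Gal(Ω/K)) (x : 𝓞 Ω) : res ν • x = ν • x := rfl
  have hker (ν : Gal(Ω/K)) : AlgEquiv.restrictNormalHom K (res ν) = 1 := by
    ext x
    apply (algebraMap K Ω).injective
    refine (AlgEquiv.restrictNormal_commutes (res ν) K x).trans ?_
    exact ν.commutes x
  obtain ⟨σ', rfl⟩ := AlgEquiv.restrictNormalHom_surjective (F := ℚ) (K₁ := K) Ω σ
  have hstab := Ideal.inertia_le_stabilizer _ hσ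
  have hunder : P.under (𝓞 K) = (σ' • P).under (𝓞 K) := by
    ext x
    rw [← hstab]
    simp only [Ideal.mem_pointwise_smul_iff_inv_smul_mem, Ideal.mem_comap]
    rw [← map_inv, restrictNormal_coe_smul]
  -- An arbitrary lift of `σ` may move `P`, but only to a prime over the same prime of `K`; an
  -- element of `Gal(Ω/K)` moves it back.
  obtain ⟨ν, hν⟩ := Algebra.IsInvariant.exists_smul_of_under_eq_of_profinite
    (A := 𝓞 K) (G := Gal(Ω/K)) P (σ' • P) hunder
  have hδ : (res ν)⁻¹ * σ' ∈ MulAction.stabilizer Gal(Ω/ℚ) P := by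
    rw [MulAction.mem_stabilizer_iff, mul_smul, hν, inv_smul_eq_iff]
    rfl
  set δ : Gal(Ω/ℚ) := (res ν)⁻¹ * σ' with hδdef
  have hδres : AlgEquiv.restrictNormalHom K δ = AlgEquiv.restrictNormalHom K σ' := by
    rw [hδdef, map_mul, map_inv, hker, inv_one, one_mul]
  let p := P.under (𝓞 K)
  let e₀ := stabilizerHom P (P.under ℤ) Gal(Ω/ℚ) ⟨δ, hδ⟩
  have he₀ (x : 𝓞 Ω) : e₀ (mk P x) = mk P (δ • x) := rfl
  let e : (𝓞 Ω ⧸ P) ≃ₐ[𝓞 K ⧸ p] (𝓞 Ω ⧸ P) := AlgEquiv.ofRingEquiv (f := e₀.toRingEquiv) <| by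
    intro x
    obtain ⟨x, rfl⟩ := mk_surjective x
    change e₀ (mk P (algebraMap (𝓞 K) (𝓞 Ω) x)) = mk P (algebraMap (𝓞 K) (𝓞 Ω) x)
    rw [he₀, ← restrictNormal_coe_smul, hδres, Ideal.Quotient.eq, ← map_sub]
    exact hσ x
  -- The residual action of `δ` is linear over the residue ring of `K`, so some `μ` in the
  -- decomposition group over `K` induces it; dividing by `μ` leaves an inertia element with the
  -- same restriction.
  obtain ⟨⟨μ, hμ⟩, hμe⟩ := stabilizerHom_surjective_of_profinite (G := Gal(Ω/K)) p P e
  refine ⟨(res μ)⁻¹ * δ, fun x ↦ ?_, by rw [map_mul, map_inv, hker, inv_one, one_mul, hδres]⟩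
  have h1 : mk P (δ • x) = mk P (μ • x) := (congr($hμe (mk P x))).symm
  have h2 : δ • x - res μ • x ∈ P := Ideal.Quotient.eq.mp h1
  have h3 : (res μ)⁻¹ • P = P := by
    rw [inv_smul_eq_iff]
    exact hμ.symm
  have h4 := (Ideal.smul_mem_pointwise_smul_iff (a := (res μ)⁻¹)).mpr h2
  rwa [h3, smul_sub, inv_smul_smul, ← mul_smul] at h4

end Inertia

/-! ### Ramification indices and square roots fixed by inertia -/

section Ramification

open scoped Pointwise

theorem numberField_of_finiteDimensional {Ω : Type*} [Field Ω] [CharZero Ω]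
    (L : IntermediateField ℚ Ω) [h : FiniteDimensional ℚ L] : NumberField L where
  to_finiteDimensional := h

/-- A prime of a number field over the rational prime `p` lies over the ideal `(p)`. -/
theorem liesOver_span_of_natCast_mem {R : Type*} [CommRing R] {P : Ideal R} [P.IsPrime] {p : ℕ}
    (hp : p.Prime) (hP : (p : R) ∈ P) : P.LiesOver (Ideal.span {(p : ℤ)}) := by
  have : (Ideal.span {(p : ℤ)}).IsMaximal := PrincipalIdealRing.isMaximal_of_irreducible
    (Nat.prime_iff_prime_int.mp hp).irreducible
  refine ⟨this.eq_of_le (Ideal.IsPrime.under ℤ P).ne_top ?_⟩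
  rw [Ideal.span_singleton_le_iff_mem, Ideal.mem_comap]
  simpa using hP

theorem Ideal.span_natCast_ne_bot {p : ℕ} (hp : p.Prime) : Ideal.span {(p : ℤ)} ≠ ⊥ := by
  simpa using hp.ne_zero

theorem perfectField_residueField_span {p : ℕ} (hp : p.Prime)
    [(Ideal.span {(p : ℤ)}).IsPrime] : PerfectField (Ideal.span {(p : ℤ)}).ResidueField := by
  have : (Ideal.span {(p : ℤ)}).IsMaximal := PrincipalIdealRing.isMaximal_of_irreducible
    (Nat.prime_iff_prime_int.mp hp).irreducible
  have : Finite (ℤ ⧸ Ideal.span {(p : ℤ)}) :=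
    Ring.HasFiniteQuotients.finiteQuotient (Ideal.span_natCast_ne_bot hp)
  infer_instance

section NumberField

variable {K : Type*} [Field K] [NumberField K] [IsGalois ℚ K] {p : ℕ} (hp : p.Prime)
  (P : Ideal (𝓞 K)) [P.IsPrime] (hP : (p : 𝓞 K) ∈ P)

include hp hP

theorem card_inertia_eq_ramificationIdxIn_span :
    Nat.card (P.inertia Gal(K/ℚ)) = (Ideal.span {(p : ℤ)}).ramificationIdxIn (𝓞 K) := by
  have := liesOver_span_of_natCast_mem hp hP
  have : (Ideal.span {(p : ℤ)}).IsPrime := Ideal.isPrime_of_liesOver P _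
  have := perfectField_residueField_span hp
  exact Ideal.card_inertia_eq_ramificationIdxIn _ P

/-- The inertia field is unramified: it contains no square root of `p` times a local unit. -/
theorem false_of_sq_eq_of_inertia_fixed {b v : 𝓞 K} (hb : ∀ σ ∈ P.inertia Gal(K/ℚ), σ • b = b)
    (hv : ∀ σ ∈ P.inertia Gal(K/ℚ), σ • v = v) (hvP : v ∉ P) (h : b ^ 2 = p * v) : False := by
  let I := P.inertia Gal(K/ℚ)
  let F : IntermediateField ℚ K := FixedPoints.intermediateField I
  have : FiniteDimensional ℚ F := inferInstance
  have : NumberField F := numberField_of_finiteDimensional F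
  have hIF : IsGaloisGroup I F K := IsGaloisGroup.subgroup Gal(K/ℚ) ℚ K I
  have hI : IsGaloisGroup I (𝓞 F) (𝓞 K) := IsGaloisGroup.of_isFractionRing _ _ _ F K
  let 𝔭 := P.under (𝓞 F)
  have h1 := liesOver_span_of_natCast_mem hp hP
  have : (Ideal.span {(p : ℤ)}).IsPrime := Ideal.isPrime_of_liesOver P _
  have := perfectField_residueField_span hp
  have hp𝔭 : (p : 𝓞 F) ∈ 𝔭 := by simpa [𝔭, Ideal.mem_comap] using hP
  have h2 : 𝔭.LiesOver (Ideal.span {(p : ℤ)}) := liesOver_span_of_natCast_mem hp hp𝔭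
  have h𝔭 : 𝔭 ≠ ⊥ := Ideal.ne_bot_of_liesOver_of_ne_bot (Ideal.span_natCast_ne_bot hp) _
  have : 𝔭.IsMaximal := (inferInstance : 𝔭.IsPrime).isMaximal h𝔭
  have : Finite (𝓞 F ⧸ 𝔭) := Ring.HasFiniteQuotients.finiteQuotient h𝔭
  have e1 := Ideal.card_inertia_eq_ramificationIdxIn (G := I) 𝔭 P
  have e2 : Nat.card (P.inertia I) = Nat.card I := by
    have : P.inertia I = ⊤ := by
      rw [eq_top_iff]
      exact fun σ _ ↦ σ.2
    rw [this, Subgroup.card_top]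
  rw [e2, card_inertia_eq_ramificationIdxIn_span hp P hP,
    Ideal.ramificationIdxIn_eq_ramificationIdx _ P Gal(K/ℚ),
    Ideal.ramificationIdxIn_eq_ramificationIdx _ P I] at e1
  -- Inertia already accounts for the whole index over the inertia field, so multiplicativity in
  -- towers leaves `1` below.
  have e3 : 𝔭.ramificationIdx ℤ = 1 := by
    have := Ideal.ramificationIdx_tower (R := ℤ) 𝔭 P
    rwa [e1, right_eq_mul₀ (Ideal.ramificationIdx_pos P (𝓞 F)).ne'] at this
  obtain ⟨b', rfl⟩ := hI.isInvariant.isInvariant b fun σ ↦ hb σ σ.2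
  obtain ⟨v', rfl⟩ := hI.isInvariant.isInvariant v fun σ ↦ hv σ σ.2
  have h' : b' ^ 2 = p * v' := by
    apply FaithfulSMul.algebraMap_injective (𝓞 F) (𝓞 K)
    simpa using h
  have hb' : b' ∈ 𝔭 := by
    refine (inferInstance : 𝔭.IsPrime).mem_of_pow_mem 2 ?_
    rw [h']
    exact 𝔭.mul_mem_right _ hp𝔭
  -- The square `b' ^ 2 = p * v'` lies in `𝔭 ^ 2` and `v'` is a unit at `𝔭`; this contradicts index
  -- `1`.
  have hp2 : (p : 𝓞 F) ∈ 𝔭 ^ 2 := by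
    have : (p : 𝓞 F) * v' ∈ 𝔭 ^ 2 := h' ▸ Ideal.pow_mem_pow hb' 2
    exact (Ideal.IsPrime.mem_pow_mul 𝔭 this).resolve_right hvP
  have hmap : (Ideal.span {(p : ℤ)}).map (algebraMap ℤ (𝓞 F)) ≠ ⊥ :=
    Ideal.map_ne_bot_of_ne_bot (Ideal.span_natCast_ne_bot hp)
  rw [Ideal.IsDedekindDomain.ramificationIdx_eq_multiplicity (Ideal.span {(p : ℤ)}) 𝔭 hmap] at e3
  have h4 : 𝔭 ^ 2 ∣ (Ideal.span {(p : ℤ)}).map (algebraMap ℤ (𝓞 F)) := by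
    rw [Ideal.dvd_iff_le, Ideal.map_span, Set.image_singleton, Ideal.span_singleton_le_iff_mem]
    simpa using hp2
  have h5 : FiniteMultiplicity 𝔭 ((Ideal.span {(p : ℤ)}).map (algebraMap ℤ (𝓞 F))) :=
    FiniteMultiplicity.of_prime_left (Ideal.prime_of_isPrime h𝔭 inferInstance) hmap
  have := h5.le_multiplicity_of_pow_dvd h4
  omega

end NumberField

variable {Ω : Type*} [Field Ω] [CharZero Ω] [IsGalois ℚ Ω]

/-- Used to descend from `𝓞 Ω`, which need not be Dedekind, to a ring of integers where powers of
primes are well behaved. -/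
theorem exists_numberField_mem (s : Set (𝓞 Ω)) (hs : s.Finite) :
    ∃ L : IntermediateField ℚ Ω, NumberField L ∧ IsGalois ℚ L ∧
      ∀ x ∈ s, ∃ y : 𝓞 L, algebraMap (𝓞 L) (𝓞 Ω) y = x := by
  have : Finite (algebraMap (𝓞 Ω) Ω '' s) := (hs.image _).to_subtype
  let L := FiniteGaloisIntermediateField.adjoin ℚ (algebraMap (𝓞 Ω) Ω '' s)
  have hN : NumberField L.toIntermediateField := numberField_of_finiteDimensional _
  refine ⟨L.toIntermediateField, hN, L.isGalois, fun x hx ↦ ?_⟩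
  have hxL : (x : Ω) ∈ L.toIntermediateField :=
    FiniteGaloisIntermediateField.subset_adjoin ℚ _ ⟨x, hx, rfl⟩
  have hint : IsIntegral ℤ (⟨x, hxL⟩ : L.toIntermediateField) := by
    rw [← isIntegral_algebraMap_iff (FaithfulSMul.algebraMap_injective L.toIntermediateField Ω)]
    exact NumberField.RingOfIntegers.isIntegral_coe x
  exact ⟨⟨_, hint⟩, NumberField.RingOfIntegers.ext rfl⟩

variable {p : ℕ} (hp : p.Prime) (P : Ideal (𝓞 Ω)) [P.IsPrime] (hP : (p : 𝓞 Ω) ∈ P)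

include hp hP

/-- No element fixed by inertia at `p` is a square root of `p` times a local unit. -/
theorem exists_inertia_smul_ne_of_sq_eq {b v : 𝓞 Ω} (hvP : v ∉ P) (h : b ^ 2 = p * v) :
    ∃ σ ∈ P.inertia Gal(Ω/ℚ), σ • b ≠ b := by
  by_contra! hb
  have hp0 : (p : 𝓞 Ω) ≠ 0 := Nat.cast_ne_zero.mpr hp.ne_zero
  have hv (σ) (hσ : σ ∈ P.inertia Gal(Ω/ℚ)) : σ • v = v := by
    have h1 : σ • (b ^ 2) = σ • ((p : 𝓞 Ω) * v) := by rw [h]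
    rw [smul_pow', hb σ hσ, h, smul_mul'] at h1
    rw [show σ • (p : 𝓞 Ω) = p from map_natCast (MulSemiringAction.toRingHom _ _ σ) p] at h1
    exact (mul_left_cancel₀ hp0 h1).symm
  obtain ⟨L, _, _, hL⟩ := exists_numberField_mem {b, v} (Set.toFinite _)
  obtain ⟨b, rfl⟩ := hL b (by simp)
  obtain ⟨v, rfl⟩ := hL v (by simp)
  have hinj := FaithfulSMul.algebraMap_injective (𝓞 L) (𝓞 Ω)
  -- Invariance passes to `L` because every inertia element of `L` lifts to an inertia element of
  -- `Ω`.
  have key {x : 𝓞 L} (hx : ∀ σ ∈ P.inertia Gal(Ω/ℚ),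
      σ • algebraMap (𝓞 L) (𝓞 Ω) x = algebraMap (𝓞 L) (𝓞 Ω) x) :
      ∀ σ ∈ (P.under (𝓞 L)).inertia Gal(L/ℚ), σ • x = x := by
    intro σ hσ
    obtain ⟨τ, hτ, rfl⟩ := exists_inertia_restrictNormal_eq L P hσ
    apply hinj
    rw [restrictNormal_coe_smul, hx τ hτ]
  refine false_of_sq_eq_of_inertia_fixed hp (P.under (𝓞 L)) ?_ (key hb) (key hv) hvP
    (hinj (by simpa using h))
  simpa [Ideal.mem_comap] using hP

/-- The order of the image of inertia is the ramification index of the field cut out. -/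
theorem card_map_inertia_eq_ramificationIdxIn {H : Type*} [Group H] (ρ : Gal(Ω/ℚ) →* H)
    (hρ : IsOpen (ρ.ker : Set Gal(Ω/ℚ))) :
    Nat.card ((P.inertia Gal(Ω/ℚ)).map ρ) =
      (Ideal.span {(p : ℤ)}).ramificationIdxIn (𝓞 (IntermediateField.fixedField ρ.ker)) := by
  let L := IntermediateField.fixedField ρ.ker
  have hfix : L.fixingSubgroup = ρ.ker :=
    InfiniteGalois.fixingSubgroup_fixedField ⟨ρ.ker, Subgroup.isClosed_of_isOpen _ hρ⟩
  have hL := (InfiniteGalois.isOpen_and_normal_iff_finite_and_isGalois L).mp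
    ⟨by rw [hfix]; exact hρ, by rw [hfix]; infer_instance⟩
  have := hL.1
  have hgal : IsGalois ℚ L := hL.2
  have : NumberField L := numberField_of_finiteDimensional L
  rw [← card_inertia_eq_ramificationIdxIn_span hp (P.under (𝓞 L))
    (by simpa [Ideal.mem_comap] using hP)]
  have hmap : (P.under (𝓞 L)).inertia Gal(L/ℚ) =
      (P.inertia Gal(Ω/ℚ)).map (AlgEquiv.restrictNormalHom L) := by
    ext σ
    constructor
    · exact exists_inertia_restrictNormal_eq L P
    · rintro ⟨τ, hτ, rfl⟩
      exact restrictNormal_mem_inertia P hτ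
  -- Both cards are indices in inertia of kernels, and restriction to `L` has the same kernel as
  -- `ρ`.
  rw [hmap, ← Subgroup.relIndex_ker, ← Subgroup.relIndex_ker]
  congr 1
  exact (hfix.symm.trans L.restrictNormalHom_ker.symm)

end Ramification

/-! ### Quadratic characters of tame inertia -/

section TameCharacter

variable {R G : Type*} [CommRing R] [IsDedekindDomain R] [Group G] [MulSemiringAction G R]
  {P : Ideal R} [P.IsPrime] (hP : P ≠ ⊥) (hI : ∀ (g : G) (x : R), g • x - x ∈ P)
  {ϖ : R} (hϖ : ϖ ∈ P) (hϖ' : ϖ ∉ P ^ 2)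

include hI in
omit [IsDedekindDomain R] [P.IsPrime] in
theorem smul_mem_pow_of_inertia (g : G) (n : ℕ) {x : R} (hx : x ∈ P ^ n) : g • x ∈ P ^ n := by
  have h1 : P.map (MulSemiringAction.toRingHom G R g) ≤ P := by
    rw [Ideal.map_le_iff_le_comap]
    intro y hy
    rw [Ideal.mem_comap]
    exact (Submodule.sub_mem_iff_left P hy).mp (hI g y)
  have h2 := Ideal.mem_map_of_mem (MulSemiringAction.toRingHom G R g) hx
  rw [Ideal.map_pow] at h2
  exact Ideal.pow_right_mono h1 n h2

include hP hI hϖ hϖ' in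
theorem exists_smul_uniformizer (g : G) : ∃ u : R, g • ϖ - u * ϖ ∈ P ^ 2 := by
  obtain ⟨d, e, he, h⟩ := Ideal.exists_mul_add_mem_pow_succ hP (i := 1) ϖ (g • ϖ)
    (by simpa using hϖ) hϖ' (smul_mem_pow_of_inertia hI g 1 (by simpa using hϖ))
  exact ⟨d, by rw [← h]; ring_nf; exact he⟩

include hϖ' in
theorem mem_of_mul_uniformizer_mem_sq {u : R} (h : u * ϖ ∈ P ^ 2) : u ∈ P := by
  rw [mul_comm] at h
  exact (Ideal.IsPrime.mem_pow_mul P h).resolve_left hϖ'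

/-- The tame character of a group acting trivially modulo `P`, with values in the residue field:
`g • ϖ ≡ θ g * ϖ mod P ^ 2`. -/
def tameCharacter : G →* R ⧸ P :=
  have hu := exists_smul_uniformizer hP hI hϖ hϖ'
  { toFun := fun g ↦ Ideal.Quotient.mk P (hu g).choose
    map_one' := by
      rw [← map_one (Ideal.Quotient.mk P), Ideal.Quotient.eq]
      refine mem_of_mul_uniformizer_mem_sq hϖ' ?_
      have := (hu 1).choose_spec
      generalize (hu 1).choose = u at this ⊢
      rw [one_smul] at this
      rw [← neg_mem_iff]
      convert this using 1
      ring
    map_mul' := fun g h ↦ by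
      rw [← map_mul, Ideal.Quotient.eq]
      refine mem_of_mul_uniformizer_mem_sq hϖ' ?_
      set a := (hu (g * h)).choose
      set b := (hu g).choose
      set c := (hu h).choose
      have h1 := smul_mem_pow_of_inertia hI g 2 (hu h).choose_spec
      have h2 := Ideal.mul_mem_left _ (g • c) (hu g).choose_spec
      have h3 : (g • c - c) * (b * ϖ) ∈ P ^ 2 := by
        rw [pow_two]
        exact Ideal.mul_mem_mul (hI g c) (P.mul_mem_left _ hϖ)
      have h4 := (hu (g * h)).choose_spec
      rw [smul_sub, smul_mul', ← mul_smul] at h1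
      convert sub_mem (add_mem (add_mem h1 h2) h3) h4 using 1
      ring }

theorem tameCharacter_eq_one_iff (g : G) :
    tameCharacter hP hI hϖ hϖ' g = 1 ↔ g • ϖ - ϖ ∈ P ^ 2 := by
  have hu := (exists_smul_uniformizer hP hI hϖ hϖ' g).choose_spec
  change Ideal.Quotient.mk P (exists_smul_uniformizer hP hI hϖ hϖ' g).choose = 1 ↔ _
  set u := (exists_smul_uniformizer hP hI hϖ hϖ' g).choose
  rw [← map_one (Ideal.Quotient.mk P), Ideal.Quotient.eq]
  constructor
  · intro h
    have : (u - 1) * ϖ ∈ P ^ 2 := by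
      rw [pow_two]
      exact Ideal.mul_mem_mul h hϖ
    convert add_mem hu this using 1
    ring
  · intro h
    refine mem_of_mul_uniformizer_mem_sq hϖ' ?_
    convert sub_mem h hu using 1
    ring

-- An element with trivial tame character acts trivially on `P / P ^ 2`, since `ϖ` spans it over `R
-- / P`. The identity `g(ab) - ab = (ga - a) gb + a (gb - b)` carries this to all the quotients `P ^
-- n / P ^ (n + 1)`.
include hP hI hϖ hϖ' in
theorem smul_sub_mem_pow_succ {g : G} (hg : g • ϖ - ϖ ∈ P ^ 2) (n : ℕ) {x : R} (hx : x ∈ P ^ n) :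
    g • x - x ∈ P ^ (n + 1) := by
  have h1 {y : R} (hy : y ∈ P) : g • y - y ∈ P ^ 2 := by
    obtain ⟨d, e, he, rfl⟩ := Ideal.exists_mul_add_mem_pow_succ hP (i := 1) ϖ y
      (by simpa using hϖ) hϖ' (by simpa using hy)
    have h2 : (g • d - d) * ϖ ∈ P ^ 2 := by
      rw [pow_two]
      exact Ideal.mul_mem_mul (hI g d) hϖ
    have h3 := sub_mem (smul_mem_pow_of_inertia hI g 2 he) he
    have h4 := Ideal.mul_mem_left _ (g • d) hg
    rw [smul_add, smul_mul']
    convert add_mem (add_mem h2 h3) h4 using 1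
    ring
  induction n generalizing x with
  | zero => simpa using hI g x
  | succ n ih =>
    rw [pow_succ] at hx
    refine Submodule.mul_induction_on hx (fun a ha b hb ↦ ?_) (fun a b ha hb ↦ ?_)
    · rw [smul_mul']
      have h2 : (g • a - a) * (g • b) ∈ P ^ (n + 1 + 1) := by
        rw [pow_succ]
        have h4 := smul_mem_pow_of_inertia hI g 1 (x := b) (by simpa using hb)
        exact Ideal.mul_mem_mul (ih ha) (by simpa using h4)
      have h3 : a * (g • b - b) ∈ P ^ (n + 1 + 1) := by
        rw [add_assoc, pow_add]
        exact Ideal.mul_mem_mul ha (h1 hb)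
      convert add_mem h2 h3 using 1
      ring
    · rw [smul_add]
      convert add_mem ha hb using 1
      ring

-- An involution `g` negates `g • x - x`. If this difference is in `P ^ n`, then `g` also fixes it
-- modulo `P ^ (n + 1)`, so twice it lies there, and `2` is a unit at `P`. Hence it lies in every
-- power of `P` and vanishes. This makes the kernel of the tame character have odd order.
include hP hI hϖ hϖ' in
theorem eq_one_of_sq_eq_one_of_tame [FaithfulSMul G R] (h2 : (2 : R) ∉ P) {g : G}
    (hg : g • ϖ - ϖ ∈ P ^ 2) (hg2 : g ^ 2 = 1) : g = 1 := by
  apply FaithfulSMul.eq_of_smul_eq_smul (α := R)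
  intro x
  rw [one_smul, ← sub_eq_zero, ← Ideal.mem_bot,
    ← Ideal.iInf_pow_eq_bot_of_isDomain P (Ideal.IsPrime.ne_top inferInstance), Ideal.mem_iInf]
  intro n
  induction n with
  | zero => simp
  | succ n ih =>
    have h3 := smul_sub_mem_pow_succ hP hI hϖ hϖ' hg n ih
    rw [smul_sub, ← mul_smul, ← pow_two, hg2, one_smul] at h3
    have h4 : (g • x - x) * 2 ∈ P ^ (n + 1) := by
      rw [← neg_mem_iff]
      convert h3 using 1
      ring
    exact (Ideal.IsPrime.mem_pow_mul P h4).resolve_right h2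

include hP hI in
/-- A finite group acting faithfully on a Dedekind domain and trivially modulo a prime `P` of
residue characteristic not `2` is cyclic up to elements of odd order. -/
theorem exists_zpow_mul_pow_eq_one_of_inertia [FaithfulSMul G R] [Finite G] (h2 : (2 : R) ∉ P) :
    ∃ (g₀ : G) (m : ℕ), ¬ 2 ∣ m ∧ ∀ x, ∃ k : ℤ, (g₀ ^ k * x) ^ m = 1 := by
  obtain ⟨ϖ, hϖ, hϖ'⟩ : ∃ ϖ ∈ P, ϖ ∉ P ^ 2 :=
    SetLike.exists_of_lt (Ideal.pow_lt_self P hP (Ideal.IsPrime.ne_top inferInstance) 2 le_rfl)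
  let θ := (tameCharacter hP hI hϖ hϖ').toHomUnits
  have hθ (x : G) : θ x = 1 ↔ x • ϖ - ϖ ∈ P ^ 2 := by
    rw [← tameCharacter_eq_one_iff hP hI hϖ hϖ', ← Units.val_eq_one]
    rfl
  have hodd : ¬ 2 ∣ Nat.card θ.ker := by
    intro hdvd
    obtain ⟨⟨x, hx⟩, hx2⟩ := exists_prime_orderOf_dvd_card' 2 hdvd
    rw [Subgroup.orderOf_mk] at hx2
    have := eq_one_of_sq_eq_one_of_tame hP hI hϖ hϖ' h2 ((hθ x).mp hx) (hx2 ▸ pow_orderOf_eq_one x)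
    simp [this] at hx2
  have : Finite θ.range := Finite.of_surjective _ θ.rangeRestrict_surjective
  have : IsCyclic θ.range := isCyclic_subgroup_units _
  obtain ⟨⟨_, g₀, rfl⟩, hg₀⟩ := IsCyclic.exists_generator (α := θ.range)
  -- Here `g₀` lifts a generator of the image of `θ`, cyclic as a finite group of units of a domain,
  -- and `m` is the odd order of the kernel.
  refine ⟨g₀, Nat.card θ.ker, hodd, fun x ↦ ?_⟩
  obtain ⟨k, hk⟩ := hg₀ ⟨θ x, x, rfl⟩
  have hk' : θ g₀ ^ k = θ x := congr_arg Subtype.val hk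
  have hx : g₀ ^ (-k) * x ∈ θ.ker := by
    rw [MonoidHom.mem_ker, map_mul, map_zpow, zpow_neg, hk', inv_mul_cancel]
  exact ⟨-k, congr_arg Subtype.val (pow_card_eq_one' (x := (⟨_, hx⟩ : θ.ker)))⟩

/-- A quadratic character kills elements of odd order, so it is determined by its value at `g₀`,
which cannot be `1`. The criterion does not mention `χ`, which is how two quadratic characters get
compared. -/
theorem map_eq_one_iff_even_of_zpow_mul_pow_eq_one {G M : Type*} [Group G] [Group M] (χ : G →* M)
    (hχ : ∀ g, χ g ^ 2 = 1) (hχ1 : ∃ g, χ g ≠ 1) {g₀ : G} {m : ℕ} (hm : ¬ 2 ∣ m)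
    (h : ∀ x, ∃ k : ℤ, (g₀ ^ k * x) ^ m = 1) {x : G} {k : ℤ} (hk : (g₀ ^ k * x) ^ m = 1) :
    χ x = 1 ↔ Even k := by
  have hker (x : G) (hx : x ^ m = 1) : χ x = 1 := by
    have h3 : χ x ^ m = 1 := by rw [← map_pow, hx, map_one]
    have h4 : Nat.Coprime 2 m := (Nat.Prime.coprime_iff_not_dvd Nat.prime_two).mpr hm
    exact orderOf_eq_one_iff.mp (Nat.dvd_one.mp (h4 ▸
      Nat.dvd_gcd (orderOf_dvd_of_pow_eq_one (hχ x)) (orderOf_dvd_of_pow_eq_one h3)))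
  have hval (x : G) (k : ℤ) (hk : (g₀ ^ k * x) ^ m = 1) : χ x = (χ g₀ ^ k)⁻¹ := by
    have := hker _ hk
    rw [map_mul, map_zpow] at this
    exact (inv_eq_of_mul_eq_one_right this).symm
  have h3 : χ g₀ ≠ 1 := by
    intro h0
    obtain ⟨y, hy⟩ := hχ1
    obtain ⟨l, hl⟩ := h y
    exact hy (by rw [hval y l hl, h0, one_zpow, inv_one])
  rw [hval x k hk, inv_eq_one, ← orderOf_dvd_iff_zpow_eq_one, even_iff_two_dvd,
    orderOf_eq_prime (hχ g₀) h3, Nat.cast_ofNat]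

end TameCharacter

/-! ### Uniqueness of the quadratic character of inertia at an odd prime -/

section LocalQuadratic

variable {Ω : Type*} [Field Ω] [CharZero Ω] [IsGalois ℚ Ω] {p : ℕ} (hp : p.Prime) (hp2 : p ≠ 2)
  (P : Ideal (𝓞 Ω)) [P.IsPrime] (hP : (p : 𝓞 Ω) ∈ P)

omit [CharZero Ω] [IsGalois ℚ Ω] in
include hp hP in
theorem intCast_notMem_of_not_dvd {a : ℤ} (ha : ¬ (p : ℤ) ∣ a) : (a : 𝓞 Ω) ∉ P := by
  intro h
  have := (liesOver_span_of_natCast_mem hp hP).over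
  apply ha
  rw [← Ideal.mem_span_singleton, this, Ideal.mem_comap]
  simpa using h

omit [CharZero Ω] [IsGalois ℚ Ω] in
include hp hp2 hP in
theorem two_notMem_of_odd_prime : (2 : 𝓞 Ω) ∉ P := by
  have : ¬ (p : ℤ) ∣ 2 := by
    intro h
    exact hp2 ((Nat.prime_dvd_prime_iff_eq hp Nat.prime_two).mp (by exact_mod_cast h))
  simpa using intCast_notMem_of_not_dvd hp P hP this

theorem exists_numberField_fixingSubgroup_le (U : Subgroup Gal(Ω/ℚ)) (hU : IsOpen (U : Set Gal(Ω/ℚ))) :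
    ∃ L : IntermediateField ℚ Ω, NumberField L ∧ IsGalois ℚ L ∧ L.fixingSubgroup ≤ U := by
  have h1 : (U : Set Gal(Ω/ℚ)) ∈ nhds 1 := hU.mem_nhds U.one_mem
  obtain ⟨L, hL⟩ := (InfiniteGalois.krullTopology_mem_nhds_one_iff_of_isGalois _).mp h1
  exact ⟨L.toIntermediateField, numberField_of_finiteDimensional _, L.isGalois, hL⟩

include hp hp2 hP in
/-- For an odd prime, inertia has at most one quadratic character with open kernel. -/
theorem map_eq_one_iff_of_quadratic_characters {M N : Type*} [Group M] [Group N]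
    (χ : P.inertia Gal(Ω/ℚ) →* M) (ψ : P.inertia Gal(Ω/ℚ) →* N)
    (U : Subgroup Gal(Ω/ℚ)) (hU : IsOpen (U : Set Gal(Ω/ℚ)))
    (hχU : ∀ σ : P.inertia Gal(Ω/ℚ), (σ : Gal(Ω/ℚ)) ∈ U → χ σ = 1)
    (hψU : ∀ σ : P.inertia Gal(Ω/ℚ), (σ : Gal(Ω/ℚ)) ∈ U → ψ σ = 1)
    (hχ : ∀ g, χ g ^ 2 = 1) (hψ : ∀ g, ψ g ^ 2 = 1) (hχ1 : ∃ g, χ g ≠ 1) (hψ1 : ∃ g, ψ g ≠ 1)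
    (g : P.inertia Gal(Ω/ℚ)) : χ g = 1 ↔ ψ g = 1 := by
  obtain ⟨L, _, _, hLU⟩ := exists_numberField_fixingSubgroup_le U hU
  let res : P.inertia Gal(Ω/ℚ) →* (P.under (𝓞 L)).inertia Gal(L/ℚ) :=
    ((AlgEquiv.restrictNormalHom L).comp (P.inertia Gal(Ω/ℚ)).subtype).codRestrict _
      fun σ ↦ restrictNormal_mem_inertia P σ.2
  have hres : Function.Surjective res := by
    rintro ⟨σ, hσ⟩
    obtain ⟨τ, hτ, rfl⟩ := exists_inertia_restrictNormal_eq L P hσ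
    exact ⟨⟨τ, hτ⟩, rfl⟩
  have hker (σ) (hσ : σ ∈ res.ker) : (σ : Gal(Ω/ℚ)) ∈ U := by
    have : @Normal ℚ L _ _ L.algebra' := (inferInstance : Normal ℚ L)
    apply hLU
    rw [← L.restrictNormalHom_ker]
    exact congr_arg Subtype.val hσ
  have hPL : (p : 𝓞 L) ∈ P.under (𝓞 L) := by simpa [Ideal.mem_comap] using hP
  have h2 : (2 : 𝓞 L) ∉ P.under (𝓞 L) := by
    rw [Ideal.mem_comap, map_ofNat]
    exact two_notMem_of_odd_prime hp hp2 P hP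
  have hbot : P.under (𝓞 L) ≠ ⊥ := by
    intro h
    rw [h, Ideal.mem_bot] at hPL
    exact hp.ne_zero (by exact_mod_cast hPL)
  have hfaith : FaithfulSMul Gal(L/ℚ) (𝓞 L) := (inferInstance : IsGaloisGroup Gal(L/ℚ) ℤ (𝓞 L)).faithful
  have : FaithfulSMul ((P.under (𝓞 L)).inertia Gal(L/ℚ)) (𝓞 L) :=
    ⟨fun h ↦ Subtype.ext (hfaith.eq_of_smul_eq_smul h)⟩
  obtain ⟨g₀, m, hm, h⟩ := exists_zpow_mul_pow_eq_one_of_inertia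
    (G := (P.under (𝓞 L)).inertia Gal(L/ℚ)) hbot (fun g ↦ g.2) h2
  -- Both characters factor through the inertia group of the finite extension `L`, where the parity
  -- of one exponent `k` decides both.
  let χ' := res.liftOfSurjective hres ⟨χ, fun σ hσ ↦ hχU σ (hker σ hσ)⟩
  let ψ' := res.liftOfSurjective hres ⟨ψ, fun σ hσ ↦ hψU σ (hker σ hσ)⟩
  have hχ' (σ) : χ' (res σ) = χ σ := MonoidHom.liftOfRightInverse_comp_apply ..
  have hψ' (σ) : ψ' (res σ) = ψ σ := MonoidHom.liftOfRightInverse_comp_apply ..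
  obtain ⟨k, hk⟩ := h (res g)
  rw [← hχ', ← hψ', map_eq_one_iff_even_of_zpow_mul_pow_eq_one χ' ?_ ?_ hm h hk,
    map_eq_one_iff_even_of_zpow_mul_pow_eq_one ψ' ?_ ?_ hm h hk]
  · exact hres.forall.mpr fun σ ↦ by rw [hψ', hψ]
  · exact hres.exists.mpr (by simpa only [hψ'] using hψ1)
  · exact hres.forall.mpr fun σ ↦ by rw [hχ', hχ]
  · exact hres.exists.mpr (by simpa only [hχ'] using hχ1)

end LocalQuadratic

/-! ### Elements on which the tame character is `-1` -/

section TameNegOne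

open SchurInvariant

instance isAlgebraic_qBar : Algebra.IsAlgebraic ℚ QBar := AlgebraicClosure.isAlgebraic ℚ

instance isGalois_qBar : IsGalois ℚ QBar :=
  have : IsAlgClosure ℚ QBar := ⟨inferInstance, inferInstance⟩
  { __ := IsAlgClosure.normal ℚ QBar }

theorem smul_eq_or_eq_neg_of_sq_eq_intCast {b : 𝓞 QBar} {a : ℤ} (hb : b ^ 2 = a) (σ : GalQ) :
    σ • b = b ∨ σ • b = -b := by
  rw [← sq_eq_sq_iff_eq_or_eq_neg, ← smul_pow', hb]
  exact map_intCast (MulSemiringAction.toRingHom _ _ σ) a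

open Classical in
/-- The quadratic character of a square root `b` of a nonzero integer. -/
def sqrtCharacter {b : 𝓞 QBar} {a : ℤ} (hb : b ^ 2 = a) (hb0 : b ≠ 0) : GalQ →* ℤˣ where
  toFun σ := if σ • b = b then 1 else -1
  map_one' := by simp
  map_mul' σ τ := by
    have hne : -b ≠ b := fun h ↦ hb0 (self_eq_neg.mp h.symm)
    rcases smul_eq_or_eq_neg_of_sq_eq_intCast hb σ with h1 | h1 <;>
    rcases smul_eq_or_eq_neg_of_sq_eq_intCast hb τ with h2 | h2 <;>
    simp [mul_smul, h1, h2, hne]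

theorem sqrtCharacter_eq_one_iff {b : 𝓞 QBar} {a : ℤ} (hb : b ^ 2 = a) (hb0 : b ≠ 0) (σ : GalQ) :
    sqrtCharacter hb hb0 σ = 1 ↔ σ • b = b := by
  classical
  change (if σ • b = b then (1 : ℤˣ) else -1) = 1 ↔ _
  split_ifs with h <;> simp [h]

variable {p : ℕ} (hp : p.Prime) {P : Ideal (𝓞 QBar)} (hP : IsPrimeAbove P p)

theorem ne_zero_of_sq_eq_intCast {b : 𝓞 QBar} {a : ℤ} (ha : ¬ (p : ℤ) ^ 2 ∣ a) (hb : b ^ 2 = a) :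
    b ≠ 0 := by
  rintro rfl
  apply ha
  have : (a : 𝓞 QBar) = 0 := by rw [← hb]; simp
  rw [Int.cast_eq_zero.mp this]
  exact dvd_zero _

include hp hP

/-- A square root of an integer exactly divisible by `p` is moved by inertia at `p`. -/
theorem exists_inertia_smul_sqrt_ne {b : 𝓞 QBar} {a : ℤ} (ha : (p : ℤ) ∣ a)
    (ha2 : ¬ (p : ℤ) ^ 2 ∣ a) (hb : b ^ 2 = a) : ∃ σ ∈ P.inertia GalQ, σ • b ≠ b := by
  have := hP.1
  obtain ⟨c, rfl⟩ := ha
  refine exists_inertia_smul_ne_of_sq_eq hp P hP.2 (v := c)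
    (intCast_notMem_of_not_dvd hp P hP.2 fun h ↦ ha2 ?_) (by rw [hb]; push_cast; rfl)
  rw [pow_two]
  exact mul_dvd_mul_left _ h

theorem map_inertia_eq_one_iff_smul_sqrt (hp2 : p ≠ 2) {b : 𝓞 QBar} {a : ℤ} (ha : (p : ℤ) ∣ a)
    (ha2 : ¬ (p : ℤ) ^ 2 ∣ a) (hb : b ^ 2 = a) {M : Type*} [Group M] (χ : P.inertia GalQ →* M)
    (U : Subgroup GalQ) (hU : IsOpen (U : Set GalQ))
    (hχU : ∀ σ : P.inertia GalQ, (σ : GalQ) ∈ U → χ σ = 1)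
    (hχ : ∀ g, χ g ^ 2 = 1) (hχ1 : ∃ g, χ g ≠ 1) (g : P.inertia GalQ) :
    χ g = 1 ↔ (g : GalQ) • b = b := by
  have := hP.1
  have hb0 := ne_zero_of_sq_eq_intCast ha2 hb
  let V := MulAction.stabilizer GalQ b
  have hV : IsOpen (V : Set GalQ) := isOpen_stabilizer_ringOfIntegers b
  obtain ⟨σ, hσ, hσb⟩ := exists_inertia_smul_sqrt_ne hp hP ha ha2 hb
  rw [← sqrtCharacter_eq_one_iff hb hb0]
  refine map_eq_one_iff_of_quadratic_characters hp hp2 P hP.2 χ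
    ((sqrtCharacter hb hb0).comp (P.inertia GalQ).subtype) (U ⊓ V) (hU.inter hV)
    (fun σ hσ ↦ hχU σ hσ.1) (fun σ hσ ↦ (sqrtCharacter_eq_one_iff hb hb0 _).mpr hσ.2) hχ
    (fun g ↦ Int.units_sq _) hχ1 ⟨⟨σ, hσ⟩, fun h ↦ hσb ((sqrtCharacter_eq_one_iff hb hb0 σ).mp h)⟩ g

/-- With `h = (p - 1) / 2`, the element `g` multiplies `ϖ ^ h` by `w ^ h ≡ (-1) ^ h` modulo `P`. As
`ϖ ^ h` is a square root of `a`, the multiplier is exactly `1` or `-1`, and these differ modulo `P`.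
-/
theorem smul_sqrt_eq_iff_of_pow_eq (hp2 : p ≠ 2) {a : ℤ} {ϖ w : 𝓞 QBar} (ha2 : ¬ (p : ℤ) ^ 2 ∣ a)
    (hϖ : ϖ ^ (p - 1) = a) {g : GalQ} (hg : g • ϖ = w * ϖ) (hw : w + 1 ∈ P) :
    g • ϖ ^ ((p - 1) / 2) = ϖ ^ ((p - 1) / 2) ↔ p % 4 = 1 := by
  have := hP.1
  have hodd := hp.eq_two_or_odd.resolve_left hp2
  set h := (p - 1) / 2 with hh
  have hh2 : h * 2 = p - 1 := by omega
  have hb : (ϖ ^ h) ^ 2 = a := by rw [← pow_mul, hh2, hϖ]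
  have hb0 := ne_zero_of_sq_eq_intCast ha2 hb
  have h2 := two_notMem_of_odd_prime hp hp2 P hP.2
  have hwh : w ^ h - (-1) ^ h ∈ P := by
    have := sub_dvd_pow_sub_pow w (-1) h
    rw [sub_neg_eq_add] at this
    exact P.mem_of_dvd this hw
  have hgb : g • ϖ ^ h = w ^ h * ϖ ^ h := by rw [smul_pow', hg, mul_pow]
  rcases smul_eq_or_eq_neg_of_sq_eq_intCast hb g with h1 | h1
  · have hw1 : w ^ h = 1 := mul_right_cancel₀ hb0 (by rw [← hgb, h1, one_mul])
    rcases Nat.even_or_odd h with he | ho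
    · have : p % 4 = 1 := by obtain ⟨k, hk⟩ := he; omega
      exact iff_of_true h1 this
    · rw [hw1, ho.neg_one_pow] at hwh
      exact absurd (by convert hwh using 1; norm_num) h2
  · have hw1 : w ^ h = -1 := mul_right_cancel₀ hb0 (by rw [← hgb, h1, neg_one_mul])
    rcases Nat.even_or_odd h with he | ho
    · rw [hw1, he.neg_one_pow] at hwh
      exact absurd (by rw [← neg_mem_iff]; convert hwh using 1; norm_num) h2
    · have : ¬ p % 4 = 1 := by obtain ⟨k, hk⟩ := ho; omega
      exact iff_of_false (fun h3 ↦ hb0 (self_eq_neg.mp (h3.symm.trans h1))) this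

/-- A ramified quadratic character of inertia at an odd prime `p` takes the value `(-1) ^ ((p-1)/2)`
at the elements that the tame character maps to `-1`. -/
theorem map_eq_one_iff_of_isTameNegOne (hp2 : p ≠ 2) {g : GalQ} (hg : IsTameNegOne p P g)
    {M : Type*} [Group M] (χ : P.inertia GalQ →* M)
    (U : Subgroup GalQ) (hU : IsOpen (U : Set GalQ))
    (hχU : ∀ σ : P.inertia GalQ, (σ : GalQ) ∈ U → χ σ = 1)
    (hχ : ∀ g, χ g ^ 2 = 1) (hχ1 : ∃ g, χ g ≠ 1) : χ ⟨g, hg.1⟩ = 1 ↔ p % 4 = 1 := by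
  obtain ⟨hgI, a, ϖ, w, ha, ha2, hϖ, hgϖ, hw⟩ := hg
  have hodd := hp.eq_two_or_odd.resolve_left hp2
  have hb : (ϖ ^ ((p - 1) / 2)) ^ 2 = a := by
    rw [← pow_mul, ← hϖ]
    congr 1
    omega
  rw [map_inertia_eq_one_iff_smul_sqrt hp hP hp2 ha ha2 hb χ U hU hχU hχ hχ1]
  exact smul_sqrt_eq_iff_of_pow_eq hp hP hp2 ha2 hϖ hgϖ hw

omit hP in
theorem exists_isPrimeAbove : ∃ P : Ideal (𝓞 QBar), IsPrimeAbove P p := by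
  have : (Ideal.span {(p : ℤ)}).IsMaximal := PrincipalIdealRing.isMaximal_of_irreducible
    (Nat.prime_iff_prime_int.mp hp).irreducible
  obtain ⟨P, hP, hPp⟩ := Ideal.exists_maximal_ideal_liesOver_of_isIntegral (S := 𝓞 QBar)
    (Ideal.span {(p : ℤ)})
  refine ⟨P, hP.isPrime, ?_⟩
  have : (p : ℤ) ∈ P.under ℤ := by
    rw [← hPp.over]
    exact Ideal.mem_span_singleton_self _
  simpa [Ideal.mem_comap] using this

/-- The tame character takes the value `-1`. -/
theorem exists_isTameNegOne : ∃ g, IsTameNegOne p P g := by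
  have := hP.1
  have hpp : ¬ (p : ℤ) ^ 2 ∣ p := by
    intro h
    have h1 := Int.le_of_dvd (by exact_mod_cast hp.pos) h
    have : (2 : ℤ) ≤ p := by exact_mod_cast hp.two_le
    nlinarith
  rcases eq_or_ne p 2 with rfl | hp2
  -- In characteristic two `-1 = 1`, so the identity works, with `a = ϖ = 2` and `w = 1`.
  · exact ⟨1, one_mem _, 2, 2, 1, by norm_num, by norm_num, by norm_num, by simp, by
      simpa [one_add_one_eq_two] using hP.2⟩
  have hodd := hp.eq_two_or_odd.resolve_left hp2
  have hp1 : 0 < p - 1 := by have := hp.two_le; omega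
  obtain ⟨x, hx⟩ := IsAlgClosed.exists_pow_nat_eq (p : QBar) hp1
  have hint : IsIntegral ℤ x := IsIntegral.of_pow hp1
    (hx ▸ by simpa using isIntegral_algebraMap (R := ℤ) (A := QBar) (x := (p : ℤ)))
  obtain ⟨ϖ, rfl⟩ : ∃ ϖ : 𝓞 QBar, (ϖ : QBar) = x := ⟨⟨x, hint⟩, rfl⟩
  have hϖ : ϖ ^ (p - 1) = ((p : ℤ) : 𝓞 QBar) := NumberField.RingOfIntegers.ext (by simpa using hx)
  set h := (p - 1) / 2 with hh
  have hb : (ϖ ^ h) ^ 2 = ((p : ℤ) : 𝓞 QBar) := by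
    rw [← pow_mul, ← hϖ]
    congr 1
    omega
  have hb0 := ne_zero_of_sq_eq_intCast hpp hb
  have hϖ0 : (ϖ : QBar) ≠ 0 := by
    intro h0
    have : ϖ = 0 := NumberField.RingOfIntegers.ext h0
    rw [this, zero_pow (by omega)] at hb0
    exact hb0 rfl
  -- Ramification of `√p` gives `σ` with `ζ = σ(ϖ) / ϖ` satisfying `ζ ^ h = -1`, so `σ ^ h` is the
  -- required element.
  obtain ⟨σ, hσ, hσb⟩ := exists_inertia_smul_sqrt_ne hp hP dvd_rfl hpp hb
  have hζint : IsIntegral ℤ (((σ • ϖ : 𝓞 QBar) : QBar) / ϖ) := by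
    refine IsIntegral.of_pow hp1 ?_
    rw [div_pow, ← map_pow, ← map_pow, ← smul_pow', hϖ,
      show σ • ((p : ℤ) : 𝓞 QBar) = (p : ℤ) from map_intCast (MulSemiringAction.toRingHom _ _ σ) _,
      div_self (by simpa using hp.ne_zero)]
    exact isIntegral_one
  obtain ⟨ζ, hζ⟩ : ∃ ζ : 𝓞 QBar, (ζ : QBar) = ((σ • ϖ : 𝓞 QBar) : QBar) / ϖ := ⟨⟨_, hζint⟩, rfl⟩
  have hσϖ : σ • ϖ = ζ * ϖ := by
    have h1 : ((σ • ϖ : 𝓞 QBar) : QBar) = (ζ : QBar) * (ϖ : QBar) := by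
      rw [hζ, div_mul_cancel₀ _ hϖ0]
    exact NumberField.RingOfIntegers.ext h1
  have hζh : ζ ^ h = -1 := by
    apply mul_right_cancel₀ hb0
    rw [← mul_pow, ← hσϖ, ← smul_pow',
      (smul_eq_or_eq_neg_of_sq_eq_intCast hb σ).resolve_left hσb, neg_one_mul]
  -- Only a congruence can be expected: `σ` may move `ζ`, but it acts trivially modulo `P`.
  have key (j : ℕ) : ∃ w : 𝓞 QBar, σ ^ j • ϖ = w * ϖ ∧ w - ζ ^ j ∈ P := by
    induction j with
    | zero => exact ⟨1, by simp, by simp⟩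
    | succ j ih =>
      obtain ⟨w, hw, hwP⟩ := ih
      refine ⟨σ • w * ζ, by rw [pow_succ', mul_smul, hw, smul_mul', hσϖ, mul_assoc], ?_⟩
      have h1 := P.mul_mem_right ζ (add_mem (hσ w) hwP)
      convert h1 using 1
      ring
  obtain ⟨w, hw, hwP⟩ := key h
  refine ⟨σ ^ h, pow_mem hσ h, p, ϖ, w, dvd_rfl, hpp, hϖ, hw, ?_⟩
  rwa [hζh, sub_neg_eq_add] at hwP

end TameNegOne

/-! ### Quadratic characters of the absolute Galois group of `ℚ` -/

section GlobalQuadratic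

open SchurInvariant

/-- Complex conjugation restricts to `QBar` under every embedding. -/
theorem exists_complexConjugation (φ : QBar →+* ℂ) :
    ∃ σ : GalQ, ∀ x : QBar, φ (σ x) = starRingEnd ℂ (φ x) := by
  let := φ.toAlgebra
  have : IsScalarTower ℚ QBar ℂ := inferInstance
  let c : ℂ ≃ₐ[ℚ] ℂ := Complex.conjAe.restrictScalars ℚ
  exact ⟨c.restrictNormal QBar, fun x ↦ c.restrictNormal_commutes QBar x⟩

theorem exists_ringHom_complex : Nonempty (QBar →+* ℂ) :=
  ⟨(IsAlgClosed.lift (R := ℚ) (S := QBar) (M := ℂ)).toRingHom⟩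

theorem exists_sq_eq_mul_squarefree {m : ℤ} (hm : m ≠ 0) :
    ∃ s d : ℤ, s ≠ 0 ∧ Squarefree d ∧ m = s ^ 2 * d := by
  obtain ⟨a, b, h, hsq⟩ := Nat.sq_mul_squarefree m.natAbs
  have hb : b ≠ 0 := by
    rintro rfl
    simp at h
    exact hm (by omega)
  refine ⟨b, m.sign * a, by exact_mod_cast hb, ?_, ?_⟩
  · rw [← Int.squarefree_natAbs, Int.natAbs_mul, Int.natAbs_sign_of_ne_zero hm]
    simpa using hsq
  · have : ((b ^ 2 * a : ℕ) : ℤ) = m.natAbs := by rw [h]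
    calc m = m.sign * m.natAbs := (Int.sign_mul_natAbs m).symm
      _ = m.sign * (b ^ 2 * a : ℕ) := by rw [this]
      _ = _ := by push_cast; ring

variable {M : Type*} [Group M] {χ : GalQ →* M}
  (hχ2 : ∀ σ τ, χ σ ≠ 1 → χ τ ≠ 1 → χ (σ * τ) = 1) (hχo : IsOpen (χ.ker : Set GalQ))

include hχ2 hχo in
/-- A quadratic character of the absolute Galois group of `ℚ` is the character of the square root
of a squarefree integer. -/
theorem exists_sqrt_of_quadratic_character (hχ : ∃ τ, χ τ ≠ 1) :
    ∃ (d : ℤ) (b : 𝓞 QBar), Squarefree d ∧ b ^ 2 = d ∧ ∀ σ, χ σ = 1 ↔ σ • b = b := by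
  obtain ⟨τ, hτ⟩ := hχ
  have hfix : (IntermediateField.fixedField χ.ker).fixingSubgroup = χ.ker :=
    InfiniteGalois.fixingSubgroup_fixedField ⟨χ.ker, Subgroup.isClosed_of_isOpen _ hχo⟩
  obtain ⟨x, hx, hxτ⟩ : ∃ x ∈ IntermediateField.fixedField χ.ker, τ x ≠ x := by
    by_contra! h
    apply hτ
    rw [← MonoidHom.mem_ker, ← hfix]
    exact (IntermediateField.mem_fixingSubgroup_iff _ τ).mpr h
  rw [IntermediateField.mem_fixedField_iff] at hx
  have h1 (σ : GalQ) (hσ : χ σ ≠ 1) : σ x = τ x := by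
    have : χ (τ⁻¹ * σ) = 1 := hχ2 _ _ (by simpa using hτ) hσ
    have h2 := hx _ (MonoidHom.mem_ker.mpr this)
    calc σ x = τ ((τ⁻¹ * σ) x) := by
            rw [← AlgEquiv.mul_apply, mul_inv_cancel_left]
      _ = τ x := by rw [h2]
  have h2 (σ : GalQ) (hσ : χ σ = 1) : σ (τ x) = τ x := by
    rw [← AlgEquiv.mul_apply]
    exact h1 _ (by rwa [map_mul, hσ, one_mul])
  have h3 (σ : GalQ) (hσ : χ σ ≠ 1) : σ (τ x) = x := by
    rw [← AlgEquiv.mul_apply]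
    exact hx _ (MonoidHom.mem_ker.mpr (hχ2 _ _ hσ hτ))
  -- The conjugates of `x` are `x` and `τ x`, so their difference changes sign with `χ` and has
  -- rational square.
  set y := x - τ x with hy
  have hy0 : y ≠ 0 := sub_ne_zero.mpr hxτ.symm
  have hy1 (σ : GalQ) (hσ : χ σ = 1) : σ y = y := by rw [hy, map_sub, h2 σ hσ, hx σ hσ]
  have hy2 (σ : GalQ) (hσ : χ σ ≠ 1) : σ y = -y := by rw [hy, map_sub, h1 σ hσ, h3 σ hσ, neg_sub]
  obtain ⟨q, hq⟩ : y ^ 2 ∈ Set.range (algebraMap ℚ QBar) := by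
    rw [InfiniteGalois.mem_range_algebraMap_iff_fixed]
    intro σ
    by_cases hσ : χ σ = 1
    · rw [map_pow, hy1 σ hσ]
    · rw [map_pow, hy2 σ hσ, neg_sq]
  have hq0 : q ≠ 0 := by
    rintro rfl
    rw [map_zero] at hq
    exact hy0 (pow_eq_zero_iff two_ne_zero |>.mp hq.symm)
  obtain ⟨s, d, hs, hd, hsd⟩ := exists_sq_eq_mul_squarefree (m := q.num * q.den)
    (mul_ne_zero (Rat.num_ne_zero.mpr hq0) (by exact_mod_cast q.den_ne_zero))
  -- Since `q.num * q.den = s ^ 2 * d`, scaling by `r` turns the square `q` into the squarefree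
  -- integer `d`.
  let r : ℚ := q.den / s
  have hs' : (s : ℚ) ≠ 0 := by exact_mod_cast hs
  have hr0 : r ≠ 0 := div_ne_zero (by exact_mod_cast q.den_ne_zero) hs'
  have hrd : r ^ 2 * q = d := by
    have h4 : (q.num : ℚ) * q.den = s ^ 2 * d := by exact_mod_cast hsd
    have h5 : q * q.den = q.num := Rat.mul_den_eq_num q
    simp only [r]
    field_simp
    rw [pow_two, mul_assoc, mul_comm (q.den : ℚ) q, h5, mul_comm, h4]
  have hb : (algebraMap ℚ QBar r * y) ^ 2 = d := by
    rw [mul_pow, ← hq, ← map_pow, ← map_mul, hrd]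
    simp
  have hint : IsIntegral ℤ (algebraMap ℚ QBar r * y) :=
    IsIntegral.of_pow two_pos (hb ▸ by simpa using isIntegral_algebraMap (R := ℤ) (A := QBar) (x := d))
  have hb0 : algebraMap ℚ QBar r * y ≠ 0 := mul_ne_zero (by simpa using hr0) hy0
  obtain ⟨b, hby⟩ : ∃ b : 𝓞 QBar, (b : QBar) = algebraMap ℚ QBar r * y := ⟨⟨_, hint⟩, rfl⟩
  rw [← hby] at hb
  refine ⟨d, b, hd, NumberField.RingOfIntegers.ext (by simpa using hb), fun σ ↦ ?_⟩
  have key : σ • b = b ↔ σ (b : QBar) = b := NumberField.RingOfIntegers.ext_iff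
  rw [key, hby]
  constructor
  · intro hσ
    rw [map_mul, AlgEquiv.commutes, hy1 σ hσ]
  · intro h
    by_contra hσ
    rw [map_mul, AlgEquiv.commutes, hy2 σ hσ, mul_neg] at h
    exact hb0 (self_eq_neg.mp h.symm)

theorem pos_of_sqrt_fixed_by_complexConjugation {d : ℤ} (hd0 : d ≠ 0) {b : 𝓞 QBar} (hb : b ^ 2 = d)
    (h : ∀ (φ : QBar →+* ℂ) (σ : GalQ), (∀ x : QBar, φ (σ x) = starRingEnd ℂ (φ x)) → σ • b = b) :
    0 < d := by
  obtain ⟨φ⟩ := exists_ringHom_complex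
  obtain ⟨σ, hσ⟩ := exists_complexConjugation φ
  have h1 : σ (b : QBar) = b := NumberField.RingOfIntegers.ext_iff.mp (h φ σ hσ)
  have h2 := hσ b
  rw [h1] at h2
  obtain ⟨r, hr⟩ := Complex.conj_eq_iff_real.mp h2.symm
  have hb' : (b : QBar) ^ 2 = d := by
    have := congr_arg (algebraMap (𝓞 QBar) QBar) hb
    simpa using this
  have h3 : (r : ℂ) ^ 2 = d := by rw [← hr, ← map_pow, hb', map_intCast]
  have h4 : r ^ 2 = d := by exact_mod_cast h3
  have h5 : (0 : ℝ) ≤ d := h4 ▸ sq_nonneg r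
  have h6 : 0 ≤ d := by exact_mod_cast h5
  omega

/-- Each other residue makes some square equal to `2` times a local unit. For `d` even it is `b ^
2`. For `d = 4k - 1` it is `(1 + b) ^ 2 = 2 (2k + b)`, where `2k + b` is a unit at `P` because `(2k
+ b)(2k - b) = 4k ^ 2 - d` is odd. -/
theorem emod_four_eq_one_of_sqrt_fixed_by_inertia {d : ℤ} (hd : Squarefree d) {b : 𝓞 QBar}
    (hb : b ^ 2 = d) {P : Ideal (𝓞 QBar)} (hP : IsPrimeAbove P 2)
    (h : ∀ σ ∈ P.inertia GalQ, σ • b = b) : d % 4 = 1 := by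
  have := hP.1
  have hd4 : ¬ (2 : ℤ) ^ 2 ∣ d := by
    intro h4
    have := hd 2 (by rwa [pow_two] at h4)
    exact absurd (Int.isUnit_iff.mp this) (by norm_num)
  have hd2 : ¬ (2 : ℤ) ∣ d := by
    intro h2
    obtain ⟨σ, hσ, hσb⟩ := exists_inertia_smul_sqrt_ne Nat.prime_two hP h2 hd4 hb
    exact hσb (h σ hσ)
  by_contra hd1
  obtain ⟨k, rfl⟩ : ∃ k, d = 4 * k - 1 := ⟨(d + 1) / 4, by omega⟩
  have hv : ((2 * k : ℤ) : 𝓞 QBar) + b ∉ P := by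
    intro hmem
    have h1 := P.mul_mem_right (((2 * k : ℤ) : 𝓞 QBar) - b) hmem
    have h2 : (((2 * k) ^ 2 - (4 * k - 1) : ℤ) : 𝓞 QBar) ∈ P := by
      convert h1 using 1
      rw [Int.cast_sub, ← hb]
      push_cast
      ring
    refine intCast_notMem_of_not_dvd Nat.prime_two P hP.2 ?_ h2
    push_cast
    intro h3
    have : (2 * k) ^ 2 - (4 * k - 1) = 2 * (2 * k ^ 2 - 2 * k) + 1 := by ring
    omega
  have h3 : (1 + b) ^ 2 = ((2 : ℕ) : 𝓞 QBar) * (((2 * k : ℤ) : 𝓞 QBar) + b) := by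
    have : (1 + b) ^ 2 = 1 + 2 * b + b ^ 2 := by ring
    rw [this, hb]
    push_cast
    ring
  obtain ⟨σ, hσ, hσb⟩ := exists_inertia_smul_ne_of_sq_eq Nat.prime_two P hP.2 hv h3
  exact hσb (by rw [smul_add, smul_one, h σ hσ])

theorem exists_inertia_smul_sqrt_ne_iff {d : ℤ} (hd : Squarefree d) {b : 𝓞 QBar}
    (hb : b ^ 2 = d) {p : ℕ} (hp : p.Prime) (hp2 : p ≠ 2) {P : Ideal (𝓞 QBar)}
    (hP : IsPrimeAbove P p) : (∃ σ ∈ P.inertia GalQ, σ • b ≠ b) ↔ (p : ℤ) ∣ d := by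
  have := hP.1
  constructor
  · rintro ⟨σ, hσ, hσb⟩
    by_contra hpd
    have h1 : σ • b - b ∈ P := hσ b
    rw [(smul_eq_or_eq_neg_of_sq_eq_intCast hb σ).resolve_left hσb] at h1
    have h2 : (2 : 𝓞 QBar) * b ∈ P := by
      rw [← neg_mem_iff]
      convert h1 using 1
      ring
    have h3 := ((inferInstance : P.IsPrime).mem_or_mem h2).resolve_left
      (two_notMem_of_odd_prime hp hp2 P hP.2)
    exact intCast_notMem_of_not_dvd hp P hP.2 hpd (hb ▸ Ideal.pow_mem_of_mem P h3 2 two_pos)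
  · intro hpd
    refine exists_inertia_smul_sqrt_ne hp hP hpd (fun h ↦ ?_) hb
    have := hd p (by rwa [pow_two] at h)
    exact (Nat.prime_iff_prime_int.mp hp).not_isUnit this

/-- Modulo `4` a squarefree odd `n` is the product of its prime factors, each `1` or `-1`. -/
theorem even_card_primeFactors_three_mod_four {n : ℕ} (hn : Squarefree n) (h : n % 4 = 1) :
    Even (n.primeFactors.filter (fun p ↦ p % 4 = 3)).card := by
  have h1 : ∏ p ∈ n.primeFactors, (p : ZMod 4) = 1 := by
    rw [← Nat.cast_prod, Nat.prod_primeFactors_of_squarefree hn, ← Nat.cast_one,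
      ZMod.natCast_eq_natCast_iff]
    exact h
  have h2 : ∀ p ∈ n.primeFactors, (p : ZMod 4) = if p % 4 = 3 then -1 else 1 := by
    intro p hp
    have hp1 := Nat.prime_of_mem_primeFactors hp
    have hp2 : p ≠ 2 := by
      rintro rfl
      have := Nat.dvd_of_mem_primeFactors hp
      omega
    have hodd := hp1.eq_two_or_odd.resolve_left hp2
    rw [← ZMod.natCast_mod p 4]
    rcases (by omega : p % 4 = 1 ∨ p % 4 = 3) with h | h <;> rw [h] <;> decide
  rw [Finset.prod_congr rfl h2, Finset.prod_ite, Finset.prod_const, Finset.prod_const_one,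
    mul_one] at h1
  by_contra hodd
  rw [Nat.not_even_iff_odd] at hodd
  rw [hodd.neg_one_pow] at h1
  exact absurd h1 (by decide)

include hχ2 hχo in
/-- A real quadratic character unramified at `2` is ramified at an even number of primes
`p ≡ 3 mod 4`. -/
theorem exists_even_card_ramified_three_mod_four (hχr : TrivialAtInfinity χ)
    (hχ₂ : ∀ P : Ideal (𝓞 QBar), IsPrimeAbove P 2 → ∀ σ ∈ P.inertia GalQ, χ σ = 1) :
    ∃ S : Finset ℕ, Even S.card ∧ (∀ p ∈ S, p.Prime) ∧
      ∀ (p : ℕ) (P : Ideal (𝓞 QBar)), p.Prime → IsPrimeAbove P p →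
        (p ∈ S ↔ p % 4 = 3 ∧ ∃ σ ∈ P.inertia GalQ, χ σ ≠ 1) := by
  by_cases hχ : ∃ τ, χ τ ≠ 1
  · obtain ⟨d, b, hd, hb, hσb⟩ := exists_sqrt_of_quadratic_character hχ2 hχo hχ
    have hpos := pos_of_sqrt_fixed_by_complexConjugation hd.ne_zero hb
      fun φ σ h ↦ (hσb σ).mp (hχr φ σ h)
    obtain ⟨P₂, hP₂⟩ := exists_isPrimeAbove Nat.prime_two
    have hd4 := emod_four_eq_one_of_sqrt_fixed_by_inertia hd hb hP₂
      fun σ hσ ↦ (hσb σ).mp (hχ₂ P₂ hP₂ σ hσ)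
    refine ⟨d.natAbs.primeFactors.filter (fun p ↦ p % 4 = 3),
      even_card_primeFactors_three_mod_four (Int.squarefree_natAbs.mpr hd) (by omega),
      fun p hp ↦ Nat.prime_of_mem_primeFactors (Finset.mem_filter.mp hp).1, fun p P hp hP ↦ ?_⟩
    rw [Finset.mem_filter, and_comm]
    refine and_congr_right fun hp4 ↦ ?_
    have hp2 : p ≠ 2 := by rintro rfl; omega
    simp only [ne_eq, hσb]
    rw [exists_inertia_smul_sqrt_ne_iff hd hb hp hp2 hP, Nat.mem_primeFactors, ← Int.natCast_dvd]
    exact ⟨fun h ↦ h.2.1, fun h ↦ ⟨hp, h, by simpa using hd.ne_zero⟩⟩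
  · push Not at hχ
    exact ⟨∅, by simp, by simp, fun p P _ _ ↦ by simp [hχ]⟩

end GlobalQuadratic

/-! ### Nonvanishing of the Schur multiplier -/

section SchurMultiplier

open Finsupp in
/-- If two elements of a central extension of `G` do not commute but their images do, then the
Schur multiplier of `G` is nontrivial. -/
theorem nontrivial_groupHomology_two_of_commutator_ne_one {G : Type} {T : Type*} [Group G] [Group T]
    (q : T →* G) (hq : Function.Surjective q) (hc : q.ker ≤ Subgroup.center T) {x y : T}
    (hxy : Commute (q x) (q y)) (hne : ⁅x, y⁆ ≠ 1) :
    Nontrivial (groupHomology (Rep.trivial ℤ G ℤ) 2) := by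
  let A := Rep.trivial ℤ G ℤ
  let s := Function.surjInv hq
  have hs (g : G) : q (s g) = g := Function.surjInv_eq hq g
  let _ : CommGroup q.ker :=
    { (inferInstance : Group q.ker) with
      mul_comm := fun a b ↦ Subtype.ext ((Subgroup.mem_center_iff.mp (hc b.2)) a) }
  have hcen (k : q.ker) (t : T) : t * k = k * t := Subgroup.mem_center_iff.mp (hc k.2) t
  have hf (g h : G) : s g * s h * (s (g * h))⁻¹ ∈ q.ker := by
    simp [MonoidHom.mem_ker, hs]
  obtain ⟨f, hf'⟩ : ∃ f : G × G → q.ker, ∀ g h, s g * s h = f (g, h) * s (g * h) :=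
    ⟨fun g ↦ ⟨_, hf g.1 g.2⟩, fun g h ↦ by simp⟩
  have hcoc (g h k : G) : f (g, h) * f (g * h, k) = f (h, k) * f (g, h * k) := by
    apply Subtype.ext
    have h1 : s g * s h * s k = (f (g, h) * f (g * h, k) : T) * s (g * h * k) := by
      rw [hf', mul_assoc, hf', mul_assoc, mul_assoc]
    have h2 : s g * s h * s k = (f (h, k) * f (g, h * k) : T) * s (g * h * k) := by
      rw [mul_assoc, hf', ← mul_assoc, hcen, mul_assoc, hf', ← mul_assoc, mul_assoc g h k]
    exact mul_right_cancel (h1.symm.trans h2)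
  -- Evaluation of 2-chains on the factor set `f`; the cocycle identity makes it vanish on
  -- boundaries.
  let φ : (G × G →₀ ℤ) →+ Additive q.ker :=
    liftAddHom fun g ↦ (zmultiplesHom (Additive q.ker)) (Additive.ofMul (f g))
  have hφ (g : G × G) (n : ℤ) : φ (single g n) = n • Additive.ofMul (f g) := by
    simp [φ]
  have hφd (z : G × G × G →₀ ℤ) : φ ((groupHomology.d₃₂ A).hom z) = 0 := by
    induction z using Finsupp.induction_linear with
    | zero => rw [map_zero, map_zero]
    | add a b ha hb =>
      rw [map_add, map_add, ha, hb, add_zero]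
    | single g n =>
      have h1 := groupHomology.d₃₂_single (A := A) g n
      refine (congr_arg φ h1).trans ?_
      change φ (single (g.2.1, g.2.2) n - single (g.1 * g.2.1, g.2.2) n +
        single (g.1, g.2.1 * g.2.2) n - single (g.1, g.2.1) n) = 0
      rw [map_sub, map_add, map_sub, hφ, hφ, hφ, hφ, ← smul_sub, ← smul_add, ← smul_sub,
        ← ofMul_div, ← ofMul_mul, ← ofMul_div]
      have h2 := hcoc g.1 g.2.1 g.2.2
      have h3 : f (g.2.1, g.2.2) / f (g.1 * g.2.1, g.2.2) * f (g.1, g.2.1 * g.2.2) / f (g.1, g.2.1)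
          = 1 := by
        rw [div_eq_one, div_mul_eq_mul_div, div_eq_iff_eq_mul, h2]
      rw [h3, ofMul_one, smul_zero]
  -- The class of a commuting pair. Evaluating `f` on it measures the failure of the chosen lifts to
  -- commute, and by centrality every pair of lifts has the same commutator.
  let c : G × G →₀ ℤ := single (q x, q y) 1 - single (q y, q x) 1
  have hcmem : c ∈ groupHomology.cycles₂ A := by
    have h1 := groupHomology.d₂₁_single (A := A) (q x, q y) (1 : ℤ)
    have h2 := groupHomology.d₂₁_single (A := A) (q y, q x) (1 : ℤ)
    change (groupHomology.d₂₁ A).hom _ = 0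
    rw [map_sub]
    refine (congr_arg₂ (· - ·) h1 h2).trans ?_
    change (single (q y) 1 - single (q x * q y) 1 + single (q x) 1) -
      (single (q x) 1 - single (q y * q x) 1 + single (q y) (1 : ℤ)) = 0
    rw [hxy.eq]
    abel
  refine ⟨groupHomology.H2π A ⟨c, hcmem⟩, 0, fun h ↦ hne ?_⟩
  rw [groupHomology.H2π_eq_zero_iff] at h
  obtain ⟨z, hz⟩ := h
  have h1 : φ c = 0 := by
    rw [← hφd z]
    exact congr_arg φ hz.symm
  rw [map_sub, hφ, hφ, one_smul, one_smul, sub_eq_zero] at h1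
  have h2 : (f (q x, q y) : T) = f (q y, q x) := congr_arg Subtype.val (Additive.ofMul.injective h1)
  have h3 : s (q x) * s (q y) = s (q y) * s (q x) := by rw [hf', hf', h2, hxy.eq]
  have hk' (t : T) : ∃ k : q.ker, t = k * s (q t) :=
    ⟨⟨t * (s (q t))⁻¹, by simp [MonoidHom.mem_ker, hs]⟩, by simp⟩
  obtain ⟨k, hk⟩ := hk' x
  obtain ⟨l, hl⟩ := hk' y
  have hmul (k l : q.ker) (a b : T) : k * a * (l * b) = k * l * (a * b) := by
    rw [mul_assoc, ← mul_assoc a, hcen l a, mul_assoc, mul_assoc]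
  rw [commutatorElement_eq_one_iff_mul_comm, hk, hl, hmul, hmul, h3, ← hcen k l]

/-- Five points of the quadratic space of traceless matrices over `ZMod 5` at equal distances. -/
def spinVector : Fin 5 → Matrix (Fin 2) (Fin 2) (ZMod 5) :=
  ![!![0, 0; 0, 0], !![0, 1; 2, 0], !![1, 2; 3, 4], !![1, 4; 4, 4], !![3, 3; 1, 2]]

/-- The difference of two of the points. -/
def spinRoot (i j : Fin 5) : Matrix (Fin 2) (Fin 2) (ZMod 5) := spinVector i - spinVector j

/-- The Clifford relation: conjugation by a vector is minus the reflection in it, and reflecting in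
the difference of two of the equidistant points interchanges these two. -/
theorem spinRoot_mul_spinRoot (i j : Fin 5) (hij : i ≠ j) (a b : Fin 5) :
    spinRoot i j * spinRoot a b =
      -(spinRoot (Equiv.swap i j a) (Equiv.swap i j b) * spinRoot i j) := by
  revert i j a b
  decide

/-- The lift of a transposition. -/
def spinSwap (i j : Fin 5) (hij : i ≠ j) : (Matrix (Fin 2) (Fin 2) (ZMod 5))ˣ where
  val := spinRoot i j
  -- A difference of two distinct points squares to the scalar `2`, whose inverse modulo `5` is `3`.
  inv := 3 * spinRoot i j
  val_inv := by revert i j; decide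
  inv_val := by revert i j; decide

/-- Multiply the lifts of transpositions. Each contributes the sign of its Clifford relation, so the
sign disappears for even permutations, and `spinCover` surjects onto `A_n`. -/
theorem exists_spinLift {n : ℕ} (hn : n ≤ 5) (σ : Equiv.Perm (Fin n)) :
    ∃ u : (Matrix (Fin 2) (Fin 2) (ZMod 5))ˣ, ∀ a b : Fin n,
      u * spinRoot (a.castLE hn) (b.castLE hn) = (Equiv.Perm.sign σ : ℤ) •
        (spinRoot ((σ a).castLE hn) ((σ b).castLE hn) * u) := by
  induction σ using Equiv.Perm.swap_induction_on with
  | one => exact ⟨1, by simp⟩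
  | swap_mul σ i j hij ih =>
    obtain ⟨u, hu⟩ := ih
    have hinj := Fin.castLE_injective hn
    have hij' : i.castLE hn ≠ j.castLE hn := hinj.ne hij
    refine ⟨spinSwap _ _ hij' * u, fun a b ↦ ?_⟩
    have h1 := spinRoot_mul_spinRoot _ _ hij' ((σ a).castLE hn) ((σ b).castLE hn)
    rw [hinj.swap_apply, hinj.swap_apply] at h1
    rw [Units.val_mul, mul_assoc, hu, mul_smul_comm, ← mul_assoc]
    change _ • (spinRoot _ _ * _ * _) = _
    rw [h1, Equiv.Perm.sign_mul, Equiv.Perm.sign_swap hij]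
    simp only [Units.val_neg, neg_mul, one_mul, smul_neg, neg_smul,
      mul_assoc, Equiv.Perm.mul_apply]
    rfl

/-- The double cover of `A_n` for `n ≤ 5`: pairs of an even permutation and a matrix that acts by
conjugation on the differences of the points of `spinVector` as the permutation does. -/
def spinCover {n : ℕ} (hn : n ≤ 5) :
    Subgroup (alternatingGroup (Fin n) × (Matrix (Fin 2) (Fin 2) (ZMod 5))ˣ) where
  carrier := {t | ∀ a b : Fin n, t.2 * spinRoot (a.castLE hn) (b.castLE hn) =
    spinRoot ((t.1.1 a).castLE hn) ((t.1.1 b).castLE hn) * t.2}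
  one_mem' a b := by simp
  mul_mem' {s t} hs ht a b := by
    change (s.2 * t.2 : Matrix (Fin 2) (Fin 2) (ZMod 5)) * _ = _ * (s.2 * t.2)
    rw [mul_assoc, ht, ← mul_assoc, hs, mul_assoc]
    rfl
  inv_mem' {t} ht a b := by
    have h := ht (t.1.1⁻¹ a) (t.1.1⁻¹ b)
    rw [← Equiv.Perm.mul_apply, ← Equiv.Perm.mul_apply, mul_inv_cancel, Equiv.Perm.one_apply,
      Equiv.Perm.one_apply] at h
    change (t.2⁻¹ : (Matrix (Fin 2) (Fin 2) (ZMod 5))ˣ) * _ =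
      spinRoot ((t.1.1⁻¹ a).castLE hn) ((t.1.1⁻¹ b).castLE hn) *
        (t.2⁻¹ : (Matrix (Fin 2) (Fin 2) (ZMod 5))ˣ)
    rw [Units.inv_mul_eq_iff_eq_mul, ← mul_assoc, h, Units.mul_inv_cancel_right]

theorem matrix_eq_scalar_of_commute_spinRoot : ∀ a b c d : ZMod 5,
    !![a, b; c, d] * spinRoot 1 0 = spinRoot 1 0 * !![a, b; c, d] →
    !![a, b; c, d] * spinRoot 2 0 = spinRoot 2 0 * !![a, b; c, d] → b = 0 ∧ c = 0 ∧ d = a := by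
  decide

/-- Two commuting double transpositions in a Klein four-group have lifts that do not commute, as
with the quaternion group. -/
theorem exists_commute_fst_spinCover {n : ℕ} (hn : n = 4 ∨ n = 5) (hn5 : n ≤ 5) :
    ∃ x y : spinCover hn5, Commute x.1.1 y.1.1 ∧
      (x.1.2 * y.1.2 : Matrix (Fin 2) (Fin 2) (ZMod 5)) ≠ y.1.2 * x.1.2 := by
  rcases hn with rfl | rfl
  · exact ⟨⟨(⟨Equiv.swap 0 1 * Equiv.swap 2 3, Equiv.Perm.mem_alternatingGroup.mpr (by decide)⟩,
      spinSwap 0 1 (by decide) * spinSwap 2 3 (by decide)), fun a b ↦ by decide +revert⟩,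
      ⟨(⟨Equiv.swap 0 2 * Equiv.swap 1 3, Equiv.Perm.mem_alternatingGroup.mpr (by decide)⟩,
      spinSwap 0 2 (by decide) * spinSwap 1 3 (by decide)), fun a b ↦ by decide +revert⟩,
      Subtype.ext (by decide +revert), by decide +revert⟩
  · exact ⟨⟨(⟨Equiv.swap 0 1 * Equiv.swap 2 3, Equiv.Perm.mem_alternatingGroup.mpr (by decide)⟩,
      spinSwap 0 1 (by decide) * spinSwap 2 3 (by decide)), fun a b ↦ by decide +revert⟩,
      ⟨(⟨Equiv.swap 0 2 * Equiv.swap 1 3, Equiv.Perm.mem_alternatingGroup.mpr (by decide)⟩,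
      spinSwap 0 2 (by decide) * spinSwap 1 3 (by decide)), fun a b ↦ by decide +revert⟩,
      Subtype.ext (by decide +revert), by decide +revert⟩

theorem nontrivial_groupHomology_two_alternatingGroup {n : ℕ} (hn : n = 4 ∨ n = 5) :
    Nontrivial (groupHomology (Rep.trivial ℤ (alternatingGroup (Fin n)) ℤ) 2) := by
  have hn5 : n ≤ 5 := by omega
  let q : spinCover hn5 →* alternatingGroup (Fin n) := (MonoidHom.fst _ _).comp (spinCover hn5).subtype
  have hq : Function.Surjective q := by
    intro σ
    obtain ⟨u, hu⟩ := exists_spinLift hn5 σ.1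
    refine ⟨⟨(σ, u), fun a b ↦ ?_⟩, rfl⟩
    rw [hu, Equiv.Perm.mem_alternatingGroup.mp σ.2]
    simp
  have hc : q.ker ≤ Subgroup.center (spinCover hn5) := by
    rintro ⟨⟨σ, u⟩, hu⟩ (rfl : σ = 1)
    have h0 : ∀ i : Fin 5, (i : ℕ) < 4 → ∃ a : Fin n, a.castLE hn5 = i :=
      fun i hi ↦ ⟨⟨i, by omega⟩, rfl⟩
    obtain ⟨a0, h0'⟩ := h0 0 (by decide)
    obtain ⟨a1, h1'⟩ := h0 1 (by decide)
    obtain ⟨a2, h2'⟩ := h0 2 (by decide)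
    have h1 := hu a1 a0
    have h2 := hu a2 a0
    simp only [OneMemClass.coe_one, Equiv.Perm.one_apply, h0', h1', h2'] at h1 h2
    rw [Matrix.eta_fin_two (u : Matrix (Fin 2) (Fin 2) (ZMod 5))] at h1 h2
    obtain ⟨e1, e2, e3⟩ := matrix_eq_scalar_of_commute_spinRoot _ _ _ _ h1 h2
    have hu' : (u : Matrix (Fin 2) (Fin 2) (ZMod 5)) = u.1 0 0 • 1 := by
      rw [Matrix.eta_fin_two (u : Matrix (Fin 2) (Fin 2) (ZMod 5)), e1, e2, e3]
      ext i j
      fin_cases i <;> fin_cases j <;> simp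
    rw [Subgroup.mem_center_iff]
    rintro ⟨⟨τ, v⟩, hv⟩
    refine Subtype.ext (Prod.ext (by simp) (Units.ext ?_))
    change (v * u : Matrix (Fin 2) (Fin 2) (ZMod 5)) = u * v
    rw [hu']
    simp
  obtain ⟨x, y, hxy, hne⟩ := exists_commute_fst_spinCover hn hn5
  refine nontrivial_groupHomology_two_of_commutator_ne_one q hq hc hxy fun h ↦ hne ?_
  exact congr_arg (fun t : spinCover hn5 ↦ (t.1.2 : Matrix (Fin 2) (Fin 2) (ZMod 5)))
    (commutatorElement_eq_one_iff_mul_comm.mp h)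

end SchurMultiplier

/-! ### Stem extensions of the alternating groups of degree four and five -/

section StemExtensions

open Subgroup

/-- A central element of the commutator subgroup, raised to the index of a subgroup `A`, is killed
in the abelianization of `A`. -/
theorem pow_index_mem_of_mem_commutator {S : Type*} [Group S] (A N : Subgroup S) [A.FiniteIndex]
    (hN : ∀ x ∈ A, ∀ y ∈ A, ⁅x, y⁆ ∈ N) {k : S} (hkc : k ∈ center S) (hk : k ∈ commutator S) :
    k ^ A.index ∈ N := by
  -- For central `k` the transfer to `A` is the class of `k ^ A.index`; it is trivial because its
  -- target is abelian and `k` is in the commutator subgroup.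
  have key (m : ℕ) (g : S) (_ : g⁻¹ * k ^ m * g ∈ A) : g⁻¹ * k ^ m * g = k ^ m := by
    rw [mul_assoc, ← mem_center_iff.mp (pow_mem hkc m) g, inv_mul_cancel_left]
  have h1 := MonoidHom.transfer_eq_pow (Abelianization.of (G := A)) k key
  have h2 : MonoidHom.transfer (Abelianization.of (G := A)) k = 1 :=
    Abelianization.commutator_subset_ker _ hk
  have h3 : (⟨k ^ A.index, MonoidHom.transfer_eq_pow_aux k key⟩ : A) ∈ commutator A := by
    rw [← Abelianization.ker_of, MonoidHom.mem_ker, ← h1, h2]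
  have h4 : commutator A ≤ N.subgroupOf A := by
    rw [commutator_def, commutator_le]
    exact fun x _ y _ ↦ hN x x.2 y y.2
  exact h4 h3

theorem commutator_mem_of_map_mem_closure_pair {S G : Type*} [Group S] [Group G] (p : S →* G)
    (hp : p.ker ≤ center S) (N : Subgroup S) [N.Normal] {u v : S} (huv : ⁅u, v⁆ ∈ N) {x y : S}
    (hx : p x ∈ closure {p u, p v}) (hy : p y ∈ closure {p u, p v}) : ⁅x, y⁆ ∈ N := by
  let q := QuotientGroup.mk' N
  have hq (a b : S) : Commute (q a) (q b) ↔ ⁅a, b⁆ ∈ N := by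
    rw [← commutatorElement_eq_one_iff_commute, ← map_commutatorElement]
    exact QuotientGroup.eq_one_iff _
  have h (x : S) (hx : p x ∈ closure {p u, p v}) : x ∈ closure ({u, v} ∪ p.ker) := by
    rw [Subgroup.closure_union, closure_eq, ← comap_map_eq, mem_comap, MonoidHom.map_closure,
      Set.image_pair]
    exact hx
  rw [← hq]
  refine closure_induction₂ (p := fun x y _ _ ↦ Commute (q x) (q y)) ?_ ?_ ?_ ?_ ?_ ?_ ?_
    (h x hx) (h y hy)
  · intro a b ha hb
    rcases ha with ha | ha
    · rcases hb with hb | hb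
      · rcases ha with rfl | rfl <;> rcases hb with rfl | rfl
        · exact Commute.refl _
        · exact (hq _ _).mpr huv
        · exact ((hq _ _).mpr huv).symm
        · exact Commute.refl _
      · exact Commute.map (mem_center_iff.mp (hp hb) a) q
    · exact (Commute.map (mem_center_iff.mp (hp ha) b) q).symm
  · intro x _; rw [map_one]; exact Commute.one_left _
  · intro x _; rw [map_one]; exact Commute.one_right _
  · intro x y z _ _ _ h1 h2; rw [map_mul]; exact h1.mul_left h2
  · intro x y z _ _ _ h1 h2; rw [map_mul]; exact h1.mul_right h2
  · intro x y _ _ h1; rw [map_inv]; exact h1.inv_left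
  · intro x y _ _ h1; rw [map_inv]; exact h1.inv_right

/-- The subgroup `{1, a, b, a * b}` generated by two commuting involutions. -/
def kleinSubgroup {G : Type*} [Group G] {a b : G} (ha : a * a = 1) (hb : b * b = 1)
    (hab : a * b = b * a) : Subgroup G where
  carrier := {1, a, b, a * b}
  one_mem' := by simp
  mul_mem' {x y} hx hy := by
    have h1 : a * (a * b) = b := by rw [← mul_assoc, ha, one_mul]
    have h2 : b * (a * b) = a := by rw [hab, ← mul_assoc, hb, one_mul]
    have h3 : a * b * a = b := by rw [hab, mul_assoc, ha, mul_one]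
    have h4 : a * b * b = a := by rw [mul_assoc, hb, mul_one]
    have h5 : a * b * (a * b) = 1 := by rw [← mul_assoc, h3, hb]
    rcases hx with rfl | rfl | rfl | rfl <;> rcases hy with rfl | rfl | rfl | rfl <;>
      simp [ha, hb, h1, h2, h3, h4, h5, ← hab]
  inv_mem' {x} hx := by
    have h5 : a * b * (a * b) = 1 := by rw [mul_assoc, ← mul_assoc b, ← hab, mul_assoc, hb, mul_one, ha]
    rcases hx with rfl | rfl | rfl | rfl
    · simp
    · rw [inv_eq_of_mul_eq_one_right ha]; simp
    · rw [inv_eq_of_mul_eq_one_right hb]; simp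
    · rw [inv_eq_of_mul_eq_one_right h5]; simp

theorem card_kleinSubgroup {G : Type*} [Group G] {a b : G} (ha : a * a = 1) (hb : b * b = 1)
    (hab : a * b = b * a) (ha1 : a ≠ 1) (hb1 : b ≠ 1) (hne : a ≠ b) :
    Nat.card (kleinSubgroup ha hb hab) = 4 := by
  change Nat.card ({1, a, b, a * b} : Set G) = 4
  have h1 : a * b ≠ 1 := fun h ↦ hne (mul_right_cancel (h.trans hb.symm))
  rw [Nat.card_coe_set_eq, Set.ncard_insert_of_notMem (by simp [ha1.symm, hb1.symm, h1.symm]),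
    Set.ncard_insert_of_notMem (by simp [hne, hb1]), Set.ncard_pair (by simp [ha1])]

theorem kleinSubgroup_le_closure {G : Type*} [Group G] {a b : G} (ha : a * a = 1) (hb : b * b = 1)
    (hab : a * b = b * a) : kleinSubgroup ha hb hab ≤ closure {a, b} := by
  have h1 : a ∈ closure {a, b} := subset_closure (by simp)
  have h2 : b ∈ closure {a, b} := subset_closure (by simp)
  rintro x (rfl | rfl | rfl | rfl)
  exacts [one_mem _, h1, h2, mul_mem h1 h2]

open SchurInvariant

/-- The preimage of a cyclic subgroup is central-by-cyclic, hence abelian; transfer to it then kills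
the index power. -/
theorem pow_eq_one_of_isStemExtension {S : Type*} {G : Type} [Group S] [Group G] [Finite G]
    {p : S →* G} (hp : IsStemExtension p) (a : G) {k : S} (hk : k ∈ p.ker) :
    k ^ (Nat.card G / orderOf a) = 1 := by
  obtain ⟨u, rfl⟩ := hp.1 a
  have h1 : (zpowers (p u)).index = Nat.card G / orderOf (p u) := by
    rw [← (zpowers (p u)).index_mul_card, Nat.card_zpowers, Nat.mul_div_cancel _ (orderOf_pos _)]
  rw [← h1, ← index_comap_of_surjective _ hp.1]
  have : ((zpowers (p u)).comap p).FiniteIndex := by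
    refine ⟨?_⟩
    rw [index_comap_of_surjective _ hp.1]
    exact FiniteIndex.index_ne_zero
  have h2 : zpowers (p u) = closure {p u, p u} := by
    rw [Set.pair_eq_singleton, zpowers_eq_closure]
  refine mem_bot.mp (pow_index_mem_of_mem_commutator _ ⊥ (fun x hx y hy ↦ ?_) (hp.2 hk).1
    (hp.2 hk).2)
  rw [mem_comap, h2] at hx hy
  exact commutator_mem_of_map_mem_closure_pair p (fun _ h ↦ (hp.2 h).1) ⊥
    (by rw [commutatorElement_self]; exact one_mem _) hx hy

/-- Transfer to the preimage of a Klein four-group. All commutators there are powers of the central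
element `⁅u, v⁆`, whose square is `⁅u ^ 2, v⁆ = 1` since `u ^ 2` is central. -/
theorem exists_pow_mem_zpowers_of_isStemExtension {S : Type*} {G : Type} [Group S] [Group G]
    [Finite G] {p : S →* G} (hp : IsStemExtension p) {a b : G} (ha : a * a = 1) (hb : b * b = 1)
    (hab : a * b = b * a) (ha1 : a ≠ 1) (hb1 : b ≠ 1) (hne : a ≠ b) :
    ∃ z : S, z ∈ center S ∧ z ^ 2 = 1 ∧ ∀ k ∈ p.ker, k ^ (Nat.card G / 4) ∈ zpowers z := by
  obtain ⟨u, rfl⟩ := hp.1 a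
  obtain ⟨v, rfl⟩ := hp.1 b
  have hz : ⁅u, v⁆ ∈ center S := (hp.2 (by
    rw [MonoidHom.mem_ker, map_commutatorElement, commutatorElement_eq_one_iff_mul_comm, hab])).1
  have hu : u * u ∈ center S := (hp.2 (by rw [MonoidHom.mem_ker, map_mul, ha])).1
  refine ⟨⁅u, v⁆, hz, ?_, fun k hk ↦ ?_⟩
  · have h1 : u * v = ⁅u, v⁆ * v * u := by rw [commutatorElement_def]; group
    have h2 : u * u * v = ⁅u, v⁆ ^ 2 * v * (u * u) := by
      rw [mul_assoc, h1, ← mul_assoc u, ← mul_assoc u, mem_center_iff.mp hz u, mul_assoc _ u v, h1,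
        pow_two]
      simp only [mul_assoc]
    rw [← mem_center_iff.mp hu v, mul_assoc] at h2
    exact right_eq_mul.mp h2
  let K := kleinSubgroup ha hb hab
  have h1 : K.index = Nat.card G / 4 := by
    rw [← K.index_mul_card, card_kleinSubgroup ha hb hab ha1 hb1 hne, Nat.mul_div_cancel _ four_pos]
  rw [← h1, ← index_comap_of_surjective _ hp.1]
  have : (K.comap p).FiniteIndex := by
    refine ⟨?_⟩
    rw [index_comap_of_surjective _ hp.1]
    exact FiniteIndex.index_ne_zero
  have : (zpowers ⁅u, v⁆).Normal := ⟨fun n hn g ↦ by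
    rw [mem_center_iff.mp (zpowers_le.mpr hz hn) g, mul_inv_cancel_right]
    exact hn⟩
  refine pow_index_mem_of_mem_commutator _ _ (fun x hx y hy ↦ ?_) (hp.2 hk).1 (hp.2 hk).2
  exact commutator_mem_of_map_mem_closure_pair p (fun _ h ↦ (hp.2 h).1) _ (mem_zpowers _)
    (kleinSubgroup_le_closure ha hb hab hx) (kleinSubgroup_le_closure ha hb hab hy)

theorem nat_card_alternatingGroup_four : Nat.card (alternatingGroup (Fin 4)) = 12 := by
  have : 2 * Nat.card (alternatingGroup (Fin 4)) = 24 := by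
    rw [two_mul_nat_card_alternatingGroup, Nat.card_perm, Nat.card_fin]
    rfl
  omega

theorem nat_card_alternatingGroup_five : Nat.card (alternatingGroup (Fin 5)) = 60 := by
  have : 2 * Nat.card (alternatingGroup (Fin 5)) = 120 := by
    rw [two_mul_nat_card_alternatingGroup, Nat.card_perm, Nat.card_fin]
    rfl
  omega

theorem exists_ker_le_zpowers_of_isStemExtension {n : ℕ} (hn : n = 4 ∨ n = 5) {S : Type*} [Group S]
    {p : S →* alternatingGroup (Fin n)} (hp : IsStemExtension p) :
    ∃ z : S, z ^ 2 = 1 ∧ p.ker ≤ zpowers z := by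
  obtain ⟨a, b, ha, hb, hab, ha1, hb1, hne, c, hc⟩ : ∃ a b : alternatingGroup (Fin n), a * a = 1 ∧
      b * b = 1 ∧ a * b = b * a ∧ a ≠ 1 ∧ b ≠ 1 ∧ a ≠ b ∧
      ∃ c : alternatingGroup (Fin n), orderOf c = 3 := by
    rcases hn with rfl | rfl
    · exact ⟨⟨Equiv.swap 0 1 * Equiv.swap 2 3, Equiv.Perm.mem_alternatingGroup.mpr (by decide)⟩,
        ⟨Equiv.swap 0 2 * Equiv.swap 1 3, Equiv.Perm.mem_alternatingGroup.mpr (by decide)⟩,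
        by decide, by decide, by decide, by decide, by decide, by decide,
        ⟨Equiv.swap 0 1 * Equiv.swap 1 2, Equiv.Perm.mem_alternatingGroup.mpr (by decide)⟩,
        orderOf_eq_prime (by decide) (by decide)⟩
    · exact ⟨⟨Equiv.swap 0 1 * Equiv.swap 2 3, Equiv.Perm.mem_alternatingGroup.mpr (by decide)⟩,
        ⟨Equiv.swap 0 2 * Equiv.swap 1 3, Equiv.Perm.mem_alternatingGroup.mpr (by decide)⟩,
        by decide, by decide, by decide, by decide, by decide, by decide,
        ⟨Equiv.swap 0 1 * Equiv.swap 1 2, Equiv.Perm.mem_alternatingGroup.mpr (by decide)⟩,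
        orderOf_eq_prime (by decide) (by decide)⟩
  obtain ⟨z, hz, hz2, hzk⟩ := exists_pow_mem_zpowers_of_isStemExtension hp ha hb hab ha1 hb1 hne
  refine ⟨z, hz2, fun k hk ↦ ?_⟩
  have h3 := pow_eq_one_of_isStemExtension hp c hk
  rw [hc] at h3
  have h4 := hzk k hk
  have : (zpowers z).Normal := ⟨fun n hn g ↦ by
    rw [mem_center_iff.mp (zpowers_le.mpr hz hn) g, mul_inv_cancel_right]
    exact hn⟩
  have hq (m : ℕ) : k ^ m ∈ zpowers z ↔ orderOf (QuotientGroup.mk' (zpowers z) k) ∣ m := by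
    rw [orderOf_dvd_iff_pow_eq_one, ← map_pow]
    exact (QuotientGroup.eq_one_iff _).symm
  have h3' := (hq _).mp (h3 ▸ one_mem _)
  rw [hq] at h4
  suffices h : orderOf (QuotientGroup.mk' (zpowers z) k) ∣ 1 by
    rw [← pow_one k]
    exact (hq 1).mpr h
  -- Modulo `z` the order of `k` divides `12 / 3 = 4` and `12 / 4 = 3` for `n = 4`. For `n = 5` it
  -- divides `60 / 3 = 20` and `60 / 4 = 15`, and a 5-cycle supplies `60 / 5 = 12` to remove the
  -- common factor `5`.
  rcases hn with rfl | rfl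
  · rw [nat_card_alternatingGroup_four] at h3' h4
    exact Nat.dvd_gcd h3' h4
  · have : Fact (Nat.Prime 5) := ⟨Nat.prime_five⟩
    have h5 : orderOf (⟨finRotate 5, Equiv.Perm.mem_alternatingGroup.mpr (by decide)⟩ :
      alternatingGroup (Fin 5)) = 5 := orderOf_eq_prime (by decide) (by decide)
    have h6 := pow_eq_one_of_isStemExtension hp
      ⟨finRotate 5, Equiv.Perm.mem_alternatingGroup.mpr (by decide)⟩ hk
    rw [h5] at h6
    have h6' := (hq _).mp (h6 ▸ one_mem _)
    rw [nat_card_alternatingGroup_five] at h3' h4 h6'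
    exact Nat.dvd_gcd (Nat.dvd_gcd h3' h4) h6'

/-- The Schur multiplier of `A₄` and of `A₅` has order two. -/
theorem card_ker_of_isSchurCover {n : ℕ} (hn : n = 4 ∨ n = 5) {S : Type*} [Group S]
    {p : S →* alternatingGroup (Fin n)} (hp : IsSchurCover p) : Nat.card p.ker = 2 := by
  obtain ⟨z, hz, hk⟩ := exists_ker_le_zpowers_of_isStemExtension hn hp.1
  have h1 : Nat.card p.ker ∣ 2 := (card_dvd_of_le hk).trans (by
    rw [Nat.card_zpowers]
    exact orderOf_dvd_of_pow_eq_one hz)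
  obtain ⟨e⟩ := hp.2
  have := nontrivial_groupHomology_two_alternatingGroup hn
  have h2 : Nontrivial p.ker := Additive.ofMul.nontrivial_congr.mpr e.toEquiv.nontrivial
  have : Finite p.ker := Nat.finite_of_card_ne_zero fun h ↦ by
    rw [h] at h1
    omega
  have h3 : 1 < Nat.card p.ker := Finite.one_lt_card
  have := Nat.le_of_dvd two_pos h1
  omega

end StemExtensions

/-! ### The reduced Schur cover of the alternating groups of degree four and five -/

section ReducedSchurCover

open Subgroup SchurInvariant

set_option maxRecDepth 10000 in
theorem exists_eq_pow_of_commute_swap_mul_swap {n : ℕ} (hn : n = 4 ∨ n = 5) :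
    ∃ σ : Equiv.Perm (Fin n), σ.IsThreeCycle ∧
      ∀ τ : Equiv.Perm (Fin n), Equiv.Perm.sign τ = 1 → Commute σ τ → τ = 1 ∨ τ = σ ∨ τ = σ ^ 2 := by
  rcases hn with rfl | rfl
  · exact ⟨Equiv.swap 0 1 * Equiv.swap 0 2,
      Equiv.Perm.isThreeCycle_swap_mul_swap_same (by decide) (by decide) (by decide), by
        unfold Commute SemiconjBy; decide⟩
  · exact ⟨Equiv.swap 0 1 * Equiv.swap 0 2,
      Equiv.Perm.isThreeCycle_swap_mul_swap_same (by decide) (by decide) (by decide), by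
        unfold Commute SemiconjBy; decide⟩

/-- At most two points lie off a 3-cycle, and swapping them is odd. One 3-cycle is checked by
enumeration; conjugation in the full symmetric group, which preserves `A_n`, handles the others. -/
theorem mem_zpowers_of_commute_of_mem_threeCycles {n : ℕ} (hn : n = 4 ∨ n = 5)
    {x y : alternatingGroup (Fin n)} (hx : x ∈ threeCycles n) (hxy : Commute x y) :
    y ∈ zpowers x := by
  obtain ⟨σ, hσ, h⟩ := exists_eq_pow_of_commute_swap_mul_swap hn
  obtain ⟨g, hg⟩ := isConj_iff.mp (Equiv.Perm.isConj_iff_cycleType_eq.mpr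
    (hσ.cycleType.trans (Equiv.Perm.IsThreeCycle.cycleType hx).symm))
  have hy : Equiv.Perm.sign (g⁻¹ * y.1 * g) = 1 := by
    rw [map_mul, map_mul, map_inv, mul_right_comm, inv_mul_cancel, one_mul]
    exact Equiv.Perm.mem_alternatingGroup.mp y.2
  have hc : Commute σ (g⁻¹ * y.1 * g) := by
    have h1 : x.1 * y.1 = y.1 * x.1 := congr_arg Subtype.val hxy
    have h2 : σ = g⁻¹ * x.1 * g := by rw [← hg]; group
    rw [h2]
    change _ = _
    simp only [mul_assoc, mul_inv_cancel_left]
    rw [← mul_assoc x.1, h1, mul_assoc]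
  have hy' : (y : Equiv.Perm (Fin n)) = g * (g⁻¹ * y.1 * g) * g⁻¹ := by group
  rcases h _ hy hc with h | h | h
  · rw [h] at hy'
    have : y = 1 := Subtype.ext (by rw [hy']; simp)
    rw [this]
    exact one_mem _
  · rw [h, hg] at hy'
    rw [Subtype.ext hy']
    exact mem_zpowers x
  · rw [h, ← conj_pow, hg] at hy'
    rw [show y = x ^ 2 from Subtype.ext hy']
    exact pow_mem (mem_zpowers x) 2

set_option maxRecDepth 10000 in
theorem isThreeCycle_of_pow_three_eq_one {n : ℕ} (hn : n = 4 ∨ n = 5) (σ : Equiv.Perm (Fin n))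
    (h1 : σ ^ 3 = 1) (h2 : σ ≠ 1) : σ.IsThreeCycle := by
  rw [← card_support_eq_three_iff]
  revert σ
  rcases hn with rfl | rfl <;> decide

theorem mem_threeCycles_iff_orderOf_eq_three {n : ℕ} (hn : n = 4 ∨ n = 5)
    {x : alternatingGroup (Fin n)} : x ∈ threeCycles n ↔ orderOf x = 3 := by
  rw [← Subgroup.orderOf_coe]
  refine ⟨fun h ↦ Equiv.Perm.IsThreeCycle.orderOf h, fun h ↦ ?_⟩
  refine isThreeCycle_of_pow_three_eq_one hn _ (h ▸ pow_orderOf_eq_one _) fun h1 ↦ ?_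
  rw [h1, orderOf_one] at h
  omega

/-- A lift of an element commuting with a 3-cycle is a power of the lift of that 3-cycle times a
central element. -/
theorem commutatorPairing_threeCycles_eq_bot {n : ℕ} (hn : n = 4 ∨ n = 5) {S : Type*} [Group S]
    {p : S →* alternatingGroup (Fin n)} (hp : p.ker ≤ center S) :
    commutatorPairing p (threeCycles n) = ⊥ := by
  rw [commutatorPairing, closure_eq_bot_iff]
  rintro _ ⟨x, y, hx, hxy, rfl⟩
  obtain ⟨k, hk⟩ := mem_zpowers_iff.mp (mem_zpowers_of_commute_of_mem_threeCycles hn hx hxy)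
  have h1 : (x ^ k)⁻¹ * y ∈ center S := hp (by
    rw [MonoidHom.mem_ker, map_mul, map_inv, map_zpow, hk, inv_mul_cancel])
  have h2 : Commute x (x ^ k * ((x ^ k)⁻¹ * y)) :=
    ((Commute.refl x).zpow_right k).mul_right (mem_center_iff.mp h1 x)
  rw [mul_inv_cancel_left] at h2
  exact commutatorElement_eq_one_iff_commute.mpr h2

/-- The reduced Schur cover of `Aₙ`, `n = 4, 5`, with respect to the 3-cycles is a central extension
by a group of order two. -/
theorem surjective_and_card_ker_of_isReducedSchurCover {n : ℕ} (hn : n = 4 ∨ n = 5) {E : Type*}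
    [Group E] {π : E →* alternatingGroup (Fin n)} (hπ : IsReducedSchurCover π (threeCycles n)) :
    Function.Surjective π ∧ π.ker ≤ center E ∧ Nat.card π.ker = 2 := by
  obtain ⟨S, _, p, q, hp, hq, rfl, hqk⟩ := hπ
  have hpc : (π.comp q).ker ≤ center S := fun _ h ↦ (hp.1.2 h).1
  rw [commutatorPairing_threeCycles_eq_bot hn hpc, MonoidHom.ker_eq_bot_iff] at hqk
  refine ⟨Function.Surjective.of_comp hp.1.1, fun k hk ↦ ?_, ?_⟩
  · obtain ⟨k, rfl⟩ := hq k
    rw [mem_center_iff]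
    intro g
    obtain ⟨g, rfl⟩ := hq g
    rw [← map_mul, ← map_mul, mem_center_iff.mp (hpc hk) g]
  · rw [← card_ker_of_isSchurCover hn hp]
    have h : π.ker = (π.comp q).ker.map q := by
      rw [← MonoidHom.comap_ker, map_comap_eq_self_of_surjective hq]
    rw [h, card_map_of_injective hqk]

/-- In a central extension by a group of order two the elements of order three map bijectively onto
the elements of order three of the quotient. -/
theorem bijOn_orderOf_eq_three {E G : Type*} [Group E] [Group G] {π : E →* G}
    (hs : Function.Surjective π) (hc : π.ker ≤ center E) (h2 : Nat.card π.ker = 2) :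
    Set.BijOn π {y | orderOf y = 3} {x | orderOf x = 3} := by
  have hk (k : E) (hk : π k = 1) : k ^ 2 = 1 := by
    have := pow_card_eq_one' (x := (⟨k, hk⟩ : π.ker))
    rw [h2] at this
    exact congr_arg Subtype.val this
  have : Fact (Nat.Prime 3) := ⟨Nat.prime_three⟩
  refine ⟨fun y hy ↦ ?_, fun y hy y' hy' h ↦ ?_, fun x hx ↦ ?_⟩
  · have h3 : y ^ 3 = 1 := orderOf_dvd_iff_pow_eq_one.mp (dvd_of_eq hy)
    refine orderOf_eq_prime (by rw [← map_pow, h3, map_one]) fun h ↦ ?_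
    have h1 := orderOf_dvd_of_pow_eq_one (hk y h)
    rw [show orderOf y = 3 from hy] at h1
    omega
  · have h3 : y ^ 3 = 1 := orderOf_dvd_iff_pow_eq_one.mp (dvd_of_eq hy)
    have h3' : y' ^ 3 = 1 := orderOf_dvd_iff_pow_eq_one.mp (dvd_of_eq hy')
    have hl : π (y⁻¹ * y') = 1 := by rw [map_mul, map_inv, h, inv_mul_cancel]
    have hcom : Commute y (y⁻¹ * y') := mem_center_iff.mp (hc hl) y
    have h4 : y' ^ 3 = y ^ 3 * (y⁻¹ * y') ^ 3 := by rw [← hcom.mul_pow, mul_inv_cancel_left]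
    rw [h3, h3', one_mul, pow_succ, hk _ hl, one_mul] at h4
    rw [← mul_one y, h4, mul_inv_cancel_left]
  · have h3 : x ^ 3 = 1 := orderOf_dvd_iff_pow_eq_one.mp (dvd_of_eq hx)
    obtain ⟨y, rfl⟩ := hs x
    -- The exponent `4` is `1` modulo `3`, so the image stays `x`, and even, so the sign of `y ^ 3`
    -- is removed.
    refine ⟨y ^ 4, orderOf_eq_prime ?_ fun h ↦ ?_, ?_⟩
    · rw [← pow_mul, mul_comm, show 3 * 4 = (3 * 2) * 2 from rfl, pow_mul, pow_mul]
      rw [hk (y ^ 3) (by rw [map_pow, h3]), one_pow]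
    · have h4 : π y = 1 := by
        rw [← map_one π, ← h, map_pow, pow_succ, h3, one_mul]
      have h5 : orderOf (π y) = 3 := hx
      rw [h4, orderOf_one] at h5
      omega
    · rw [map_pow, pow_succ, h3, one_mul]

end ReducedSchurCover

/-! ### Tame real lifts and their ramification -/

section TameLifts

open Subgroup SchurInvariant

theorem finite_setOf_even_ramificationIdxIn (K : Type*) [Field K] [NumberField K] :
    {p : ℕ | p.Prime ∧ Even ((Ideal.span {(p : ℤ)}).ramificationIdxIn (𝓞 K))}.Finite := by
  refine (NumberField.discr K).natAbs.divisors.finite_toSet.subset ?_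
  rintro p ⟨hp, he⟩
  rw [Finset.mem_coe, Nat.mem_divisors, ← Int.natCast_dvd]
  refine ⟨?_, Int.natAbs_ne_zero.mpr (NumberField.discr_ne_zero K)⟩
  by_contra hd
  rw [NumberField.not_dvd_discr_iff_isUnramifiedIn K (𝓞 K) (Nat.prime_iff_prime_int.mp hp)] at hd
  have : (Ideal.span {(p : ℤ)}).IsPrime :=
    (Ideal.span_singleton_prime (by exact_mod_cast hp.ne_zero)).mpr (Nat.prime_iff_prime_int.mp hp)
  obtain ⟨⟨Q, hQ, hQp⟩⟩ := (Ideal.span {(p : ℤ)}).nonempty_primesOver (S := 𝓞 K)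
  -- A prime above `p` must be exhibited, since the default value `0` of `ramificationIdxIn` would
  -- count as even.
  have hex : ∃ Q : Ideal (𝓞 K), Q.IsPrime ∧ Q.LiesOver (Ideal.span {(p : ℤ)}) := ⟨Q, hQ, hQp⟩
  rw [Ideal.ramificationIdxIn, dif_pos hex] at he
  have := hex.choose_spec.1
  rw [hd.ramificationIdx_eq_one hex.choose_spec.2] at he
  exact absurd he (by decide)

theorem finite_evenRamifiedThreeModFour_fieldOf {H : Type*} [Group H] {ρ : GalQ →* H}
    (hρ : IsOpen (ρ.ker : Set GalQ)) : (evenRamifiedThreeModFour (fieldOf ρ)).Finite := by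
  have hfix : (fieldOf ρ).fixingSubgroup = ρ.ker :=
    InfiniteGalois.fixingSubgroup_fixedField ⟨ρ.ker, Subgroup.isClosed_of_isOpen _ hρ⟩
  have hL := (InfiniteGalois.isOpen_and_normal_iff_finite_and_isGalois (fieldOf ρ)).mp
    ⟨by rw [hfix]; exact hρ, by rw [hfix]; infer_instance⟩
  have := hL.1
  have : NumberField (fieldOf ρ) := numberField_of_finiteDimensional _
  exact (finite_setOf_even_ramificationIdxIn (fieldOf ρ)).subset fun p hp ↦ ⟨hp.1, hp.2.2⟩

variable {E G : Type*} [Group E] [Group G] {π : E →* G} {c : Set G} {ρ : GalQ →* G}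
  {ρt : GalQ →* E} {p : ℕ} {P : Ideal (𝓞 QBar)}

theorem sq_eq_one_of_card_ker (h2 : Nat.card π.ker = 2) {k : E} (hk : π k = 1) : k ^ 2 = 1 := by
  have := pow_card_eq_one' (x := (⟨k, hk⟩ : π.ker))
  rw [h2] at this
  exact congr_arg Subtype.val this

theorem eq_of_card_ker (h2 : Nat.card π.ker = 2) {k l : E} (hk : π k = 1) (hl : π l = 1)
    (hk1 : k ≠ 1) (hl1 : l ≠ 1) : k = l := by
  have h := (Nat.card_eq_two_iff' (1 : π.ker)).mp h2
  exact congr_arg Subtype.val (h.unique (y₁ := ⟨k, hk⟩) (y₂ := ⟨l, hl⟩)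
    (fun h ↦ hk1 (congr_arg Subtype.val h)) (fun h ↦ hl1 (congr_arg Subtype.val h)))

theorem pow_three_eq_one_of_ramificationOfType (hc : ∀ x ∈ c, orderOf x = 3)
    (hρ : RamificationOfType ρ c) (hp : p.Prime) (hP : IsPrimeAbove P p) {σ : GalQ}
    (hσ : σ ∈ P.inertia GalQ) : ρ σ ^ 3 = 1 := by
  obtain ⟨x, hx, h⟩ := hρ.2 p P hp hP
  have h1 : ρ σ ∈ zpowers x := h ▸ mem_map_of_mem ρ hσ
  obtain ⟨k, hk⟩ := mem_zpowers_iff.mp h1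
  have h3 : x ^ 3 = 1 := by
    rcases hx with rfl | hx
    · exact one_pow 3
    · exact orderOf_dvd_iff_pow_eq_one.mp (dvd_of_eq (hc x hx))
  rw [← hk, ← zpow_natCast, zpow_comm, zpow_natCast, h3, one_zpow]

/-- The image of inertia in `E` is central-by-cyclic, hence abelian. This makes cubing a
homomorphism on it. -/
theorem commute_of_ramificationOfType (hπ : π.ker ≤ center E) (hρ : RamificationOfType ρ c)
    (hρt : π.comp ρt = ρ) (hp : p.Prime) (hP : IsPrimeAbove P p) {σ τ : GalQ}
    (hσ : σ ∈ P.inertia GalQ) (hτ : τ ∈ P.inertia GalQ) : Commute (ρt σ) (ρt τ) := by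
  obtain ⟨x, -, h⟩ := hρ.2 p P hp hP
  obtain ⟨υ, -, hυ⟩ : x ∈ (P.inertia GalQ).map ρ := h ▸ mem_zpowers x
  have h1 (σ : GalQ) (hσ : σ ∈ P.inertia GalQ) :
      π (ρt σ) ∈ closure {π (ρt υ), π (ρt υ)} := by
    rw [Set.pair_eq_singleton, ← zpowers_eq_closure]
    change (π.comp ρt) σ ∈ zpowers ((π.comp ρt) υ)
    rw [hρt, hυ, ← h]
    exact mem_map_of_mem ρ hσ
  exact commutatorElement_eq_one_iff_commute.mp (mem_bot.mp
    (commutator_mem_of_map_mem_closure_pair π hπ ⊥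
      (by rw [commutatorElement_self]; exact one_mem _) (h1 σ hσ) (h1 τ hτ)))

theorem map_pow_three_eq_one (hc : ∀ x ∈ c, orderOf x = 3) (hρ : RamificationOfType ρ c)
    (hρt : π.comp ρt = ρ) (hp : p.Prime) (hP : IsPrimeAbove P p) {σ : GalQ}
    (hσ : σ ∈ P.inertia GalQ) : π (ρt σ ^ 3) = 1 := by
  rw [map_pow]
  change (π.comp ρt) σ ^ 3 = 1
  rw [hρt]
  exact pow_three_eq_one_of_ramificationOfType hc hρ hp hP hσ

theorem even_card_map_inertia_iff (h2 : Nat.card π.ker = 2) (hc : ∀ x ∈ c, orderOf x = 3)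
    (hρ : RamificationOfType ρ c) (hρt : π.comp ρt = ρ) (ht : TamelyRamified ρt) (hp : p.Prime)
    (hP : IsPrimeAbove P p) :
    Even (Nat.card ((P.inertia GalQ).map ρt)) ↔ ∃ σ ∈ P.inertia GalQ, ρt σ ^ 3 ≠ 1 := by
  -- An infinite group has `Nat.card` equal to `0`, which is not coprime to `p`, so tameness gives
  -- finiteness.
  have hfin : Finite ((P.inertia GalQ).map ρt) := Nat.finite_of_card_ne_zero fun h ↦ by
    have := ht p P hp hP
    rw [h, Nat.coprime_zero_left] at this
    exact hp.one_lt.ne' this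
  constructor
  · intro h
    have : Fact (Nat.Prime 2) := ⟨Nat.prime_two⟩
    obtain ⟨⟨y, σ, hσ, rfl⟩, hy⟩ := exists_prime_orderOf_dvd_card' 2 h.two_dvd
    rw [← Subgroup.orderOf_coe] at hy
    refine ⟨σ, hσ, fun h3 ↦ ?_⟩
    have h4 := orderOf_dvd_of_pow_eq_one h3
    change orderOf (ρt σ) = 2 at hy
    rw [hy] at h4
    omega
  · rintro ⟨σ, hσ, h⟩
    have hsq := sq_eq_one_of_card_ker h2 (map_pow_three_eq_one hc hρ hρt hp hP hσ)
    have : Fact (Nat.Prime 2) := ⟨Nat.prime_two⟩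
    have h3 := orderOf_eq_prime hsq h
    have h4 := orderOf_dvd_natCard (⟨ρt σ ^ 3, pow_mem (mem_map_of_mem ρt hσ) 3⟩ :
      (P.inertia GalQ).map ρt)
    rw [← Subgroup.orderOf_coe] at h4
    change orderOf (ρt σ ^ 3) ∣ _ at h4
    rw [h3] at h4
    exact even_iff_two_dvd.mpr h4

theorem pow_three_eq_one_of_isPrimeAbove_two (h2 : Nat.card π.ker = 2)
    (hc : ∀ x ∈ c, orderOf x = 3) (hρ : RamificationOfType ρ c) (hρt : π.comp ρt = ρ)
    (ht : TamelyRamified ρt) (hP : IsPrimeAbove P 2) {σ : GalQ} (hσ : σ ∈ P.inertia GalQ) :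
    ρt σ ^ 3 = 1 := by
  by_contra h
  have h1 := (even_card_map_inertia_iff h2 hc hρ hρt ht Nat.prime_two hP).mpr ⟨σ, hσ, h⟩
  exact Nat.not_coprime_of_dvd_of_dvd one_lt_two h1.two_dvd dvd_rfl
    (ht 2 P Nat.prime_two hP)

/-- The local factor of the invariant of `ρ` at `p` is nontrivial if and only if `p ≡ 3 mod 4` and
the ramification index of `p` is even. -/
theorem pow_three_ne_one_iff_mem_evenRamifiedThreeModFour (hπ : π.ker ≤ center E)
    (h2 : Nat.card π.ker = 2) (hc : ∀ x ∈ c, orderOf x = 3) (hρ : RamificationOfType ρ c)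
    (hρt : IsTameRealLift π ρ ρt) (hp : p.Prime) (hP : IsPrimeAbove P p) {g : GalQ}
    (hg : IsTameNegOne p P g) :
    ρt g ^ 3 ≠ 1 ↔ p ∈ evenRamifiedThreeModFour (fieldOf ρt) := by
  obtain ⟨hl, ho, -, ht⟩ := hρt
  have := hP.1
  have hiff : p ∈ evenRamifiedThreeModFour (fieldOf ρt) ↔
      p % 4 = 3 ∧ ∃ σ ∈ P.inertia GalQ, ρt σ ^ 3 ≠ 1 := by
    rw [← even_card_map_inertia_iff h2 hc hρ hl ht hp hP,
      card_map_inertia_eq_ramificationIdxIn hp P hP.2 ρt ho]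
    exact and_iff_right hp
  rw [hiff]
  by_cases hp2 : p = 2
  · subst hp2
    refine iff_of_false (fun h ↦ h ?_) fun h ↦ absurd h.1 (by decide)
    exact pow_three_eq_one_of_isPrimeAbove_two h2 hc hρ hl ht hP hg.1
  by_cases hex : ∃ σ ∈ P.inertia GalQ, ρt σ ^ 3 ≠ 1
  · obtain ⟨σ, hσ, h⟩ := hex
    -- Cubing sends inertia into the kernel of order two, so this is a quadratic character, and its
    -- value at `g` is known.
    let χ : P.inertia GalQ →* E :=
      { toFun := fun σ ↦ ρt σ ^ 3
        map_one' := by simp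
        map_mul' := fun σ τ ↦ by
          rw [coe_mul, map_mul]
          exact (commute_of_ramificationOfType hπ hρ hl hp hP σ.2 τ.2).mul_pow 3 }
    have key := map_eq_one_iff_of_isTameNegOne hp hP hp2 hg χ ρt.ker ho
      (fun σ hσ ↦ by
        change ρt σ ^ 3 = 1
        rw [MonoidHom.mem_ker.mp hσ, one_pow])
      (fun σ ↦ sq_eq_one_of_card_ker h2 (map_pow_three_eq_one hc hρ hl hp hP σ.2))
      ⟨⟨σ, hσ⟩, h⟩
    have hodd := (hp.eq_two_or_odd).resolve_left hp2
    change ¬ (χ ⟨g, hg.1⟩ = 1) ↔ _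
    rw [key]
    constructor
    · exact fun h' ↦ ⟨by omega, σ, hσ, h⟩
    · rintro ⟨h', -⟩
      omega
  · exact iff_of_false (fun h ↦ hex ⟨g, hg.1, h⟩) fun h ↦ hex h.2

/-- Put `k = y * s⁻¹`, central with `k ^ 2 = 1`. Then `y ^ 3 = k ^ 3 * s ^ 3 = k`. The distinguished
lift thereby drops out of the local factor. -/
theorem mul_inv_eq_pow_three (hπ : π.ker ≤ center E) (h2 : Nat.card π.ker = 2) {y s : E}
    (hs : s ∈ insert 1 {y : E | orderOf y = 3}) (hys : π s = π y) : y * s⁻¹ = y ^ 3 := by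
  have hs3 : s ^ 3 = 1 := by
    rcases hs with rfl | hs
    · exact one_pow 3
    · exact orderOf_dvd_iff_pow_eq_one.mp (dvd_of_eq hs)
  have hk : π (y * s⁻¹) = 1 := by rw [map_mul, map_inv, hys, mul_inv_cancel]
  have hcom : Commute (y * s⁻¹) s := (mem_center_iff.mp (hπ hk) s).symm
  have h1 : y ^ 3 = (y * s⁻¹) ^ 3 * s ^ 3 := by rw [← hcom.mul_pow, inv_mul_cancel_right]
  rw [h1, hs3, mul_one, pow_succ, sq_eq_one_of_card_ker h2 hk, one_mul]

/-- The quotient of two lifts of `ρ` along a central extension. -/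
def liftQuotient (hπ : π.ker ≤ center E) {ρ₁ ρ₂ : GalQ →* E} (h : π.comp ρ₁ = π.comp ρ₂) :
    GalQ →* E where
  toFun σ := ρ₁ σ * (ρ₂ σ)⁻¹
  map_one' := by simp
  map_mul' σ τ := by
    have hk : π (ρ₁ τ * (ρ₂ τ)⁻¹) = 1 := by
      rw [map_mul, map_inv]
      exact mul_inv_eq_one.mpr (DFunLike.congr_fun h τ)
    have h1 := mem_center_iff.mp (hπ hk) (ρ₂ σ)⁻¹
    rw [map_mul, map_mul, mul_inv_rev, mul_assoc (ρ₁ σ) (ρ₂ σ)⁻¹, h1]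
    simp only [mul_assoc]

theorem map_liftQuotient (hπ : π.ker ≤ center E) {ρ₁ ρ₂ : GalQ →* E}
    (h : π.comp ρ₁ = π.comp ρ₂) (σ : GalQ) : π (liftQuotient hπ h σ) = 1 := by
  change π (ρ₁ σ * (ρ₂ σ)⁻¹) = 1
  rw [map_mul, map_inv]
  exact mul_inv_eq_one.mpr (DFunLike.congr_fun h σ)

theorem liftQuotient_mul_pow_three (hπ : π.ker ≤ center E) (h2 : Nat.card π.ker = 2)
    {ρ₁ ρ₂ : GalQ →* E} (h : π.comp ρ₁ = π.comp ρ₂) (σ : GalQ) :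
    ρ₁ σ ^ 3 = liftQuotient hπ h σ * ρ₂ σ ^ 3 := by
  have hk := map_liftQuotient hπ h σ
  have h1 : ρ₁ σ = liftQuotient hπ h σ * ρ₂ σ := (inv_mul_cancel_right _ _).symm
  have hcom : Commute (liftQuotient hπ h σ) (ρ₂ σ) := (mem_center_iff.mp (hπ hk) _).symm
  rw [h1, hcom.mul_pow, pow_succ (liftQuotient hπ h σ), sq_eq_one_of_card_ker h2 hk, one_mul]

theorem ncard_eq_ncard_of_even_symmDiff {α : Type*} {A B : Set α} (hA : A.Finite) (hB : B.Finite)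
    {S : Finset α} (hS : Even S.card) (h : ∀ a, a ∈ S ↔ ¬ (a ∈ A ↔ a ∈ B)) :
    ((A.ncard : ℕ) : ZMod 2) = B.ncard := by
  have h1 := Set.ncard_inter_add_ncard_sdiff_eq_ncard A B hA
  have h2 := Set.ncard_inter_add_ncard_sdiff_eq_ncard B A hB
  have h3 : (S : Set α) = (A \ B) ∪ (B \ A) := by
    ext a
    simp only [Finset.mem_coe, h, Set.mem_union, Set.mem_sdiff]
    tauto
  have h4 : S.card = (A \ B).ncard + (B \ A).ncard := by
    rw [← Set.ncard_coe_finset, h3, Set.ncard_union_eq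
      (Set.disjoint_left.mpr fun a h h' ↦ h'.2 h.1) hA.sdiff hB.sdiff]
  rw [Set.inter_comm] at h2
  obtain ⟨r, hr⟩ := hS
  rw [ZMod.natCast_eq_natCast_iff']
  omega

/-- The two sets differ exactly at the primes `≡ 3 mod 4` where the quotient `χ` of the lifts
ramifies. This quotient is trivial at infinity, and on inertia at `2` because both cubes are, so the
number of those primes is even. -/
theorem ncard_evenRamifiedThreeModFour_eq (hπ : π.ker ≤ center E)
    (h2 : Nat.card π.ker = 2) (hc : ∀ x ∈ c, orderOf x = 3) (hρ : RamificationOfType ρ c)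
    {ρ₁ ρ₂ : GalQ →* E} (h₁ : IsTameRealLift π ρ ρ₁) (h₂ : IsTameRealLift π ρ ρ₂) :
    (((evenRamifiedThreeModFour (fieldOf ρ₁)).ncard : ℕ) : ZMod 2) =
      (evenRamifiedThreeModFour (fieldOf ρ₂)).ncard := by
  have h := h₁.1.trans h₂.1.symm
  let χ := liftQuotient hπ h
  have hχ (σ : GalQ) : π (χ σ) = 1 := map_liftQuotient hπ h σ
  have hχ3 (σ : GalQ) : ρ₁ σ ^ 3 = χ σ * ρ₂ σ ^ 3 := liftQuotient_mul_pow_three hπ h2 h σ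
  have hχo : IsOpen (χ.ker : Set GalQ) := by
    refine isOpen_mono (H₁ := ρ₁.ker ⊓ ρ₂.ker) (fun σ hσ ↦ ?_) (h₁.2.1.inter h₂.2.1)
    change ρ₁ σ * (ρ₂ σ)⁻¹ = 1
    rw [MonoidHom.mem_ker.mp hσ.1, MonoidHom.mem_ker.mp hσ.2, inv_one, mul_one]
  have hχ₂ (P : Ideal (𝓞 QBar)) (hP : IsPrimeAbove P 2) (σ : GalQ) (hσ : σ ∈ P.inertia GalQ) :
      χ σ = 1 := by
    have := hχ3 σ
    rw [pow_three_eq_one_of_isPrimeAbove_two h2 hc hρ h₁.1 h₁.2.2.2 hP hσ,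
      pow_three_eq_one_of_isPrimeAbove_two h2 hc hρ h₂.1 h₂.2.2.2 hP hσ, mul_one] at this
    exact this.symm
  obtain ⟨S, hS, hSp, hSiff⟩ := exists_even_card_ramified_three_mod_four (χ := χ)
    (fun σ τ hσ hτ ↦ by
      rw [map_mul, eq_of_card_ker h2 (hχ σ) (hχ τ) hσ hτ, ← pow_two]
      exact sq_eq_one_of_card_ker h2 (hχ τ)) hχo
    (fun φ σ hσ ↦ by
      change ρ₁ σ * (ρ₂ σ)⁻¹ = 1
      rw [h₁.2.2.1 φ σ hσ, h₂.2.2.1 φ σ hσ, inv_one, mul_one])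
    hχ₂
  refine ncard_eq_ncard_of_even_symmDiff (finite_evenRamifiedThreeModFour_fieldOf h₁.2.1)
    (finite_evenRamifiedThreeModFour_fieldOf h₂.2.1) hS fun p ↦ ?_
  by_cases hp : p.Prime
  swap
  · exact iff_of_false (fun h ↦ hp (hSp p h)) fun h' ↦ h'
      (iff_of_false (fun h ↦ hp h.1) fun h ↦ hp h.1)
  obtain ⟨P, hP⟩ := exists_isPrimeAbove hp
  obtain ⟨g, hg⟩ := exists_isTameNegOne hp hP
  rw [hSiff p P hp hP, ← pow_three_ne_one_iff_mem_evenRamifiedThreeModFour hπ h2 hc hρ h₁ hp hP hg,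
    ← pow_three_ne_one_iff_mem_evenRamifiedThreeModFour hπ h2 hc hρ h₂ hp hP hg, not_iff_not]
  have hiff : (p % 4 = 3 ∧ ∃ σ ∈ P.inertia GalQ, χ σ ≠ 1) ↔ χ g ≠ 1 := by
    by_cases hex : ∃ σ ∈ P.inertia GalQ, χ σ ≠ 1
    swap
    · exact iff_of_false (fun h ↦ hex h.2) fun h ↦ hex ⟨g, hg.1, h⟩
    by_cases hp2 : p = 2
    · subst hp2
      exact absurd hex (by push Not; exact hχ₂ P hP)
    obtain ⟨σ, hσ, hσ1⟩ := hex
    have key := map_eq_one_iff_of_isTameNegOne hp hP hp2 hg (χ.comp (P.inertia GalQ).subtype)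
      χ.ker hχo (fun σ hσ ↦ hσ) (fun σ ↦ sq_eq_one_of_card_ker h2 (hχ σ)) ⟨⟨σ, hσ⟩, hσ1⟩
    have hodd := (hp.eq_two_or_odd).resolve_left hp2
    change _ ↔ ¬ (χ.comp (P.inertia GalQ).subtype ⟨g, hg.1⟩ = 1)
    rw [key]
    exact ⟨fun h ↦ by omega, fun h ↦ ⟨by omega, σ, hσ, hσ1⟩⟩
  rw [hiff, hχ3 g]
  have hk := hχ g
  have hl := map_pow_three_eq_one hc hρ h₂.1 hp hP hg.1
  -- In a kernel of order two, `χ g * ρ₂ g ^ 3` is nontrivial exactly when one factor is, which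
  -- gives the symmetric difference.
  by_cases h3 : ρ₂ g ^ 3 = 1
  · rw [h3, mul_one]
    tauto
  · by_cases h4 : χ g = 1
    · rw [h4, one_mul]
      tauto
    · have h5 : χ g * ρ₂ g ^ 3 = 1 := by
        rw [eq_of_card_ker h2 hk hl h4 h3, ← pow_two]
        exact sq_eq_one_of_card_ker h2 hl
      tauto

theorem finprod_eq_pow_ncard {α M : Type*} [CommMonoid M] (f : α → M) (A : Set α) (z : M)
    (hA : A.Finite) (h1 : ∀ a ∉ A, f a = 1) (hz : ∀ a ∈ A, f a = z) : ∏ᶠ a, f a = z ^ A.ncard := by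
  rw [finprod_eq_prod_of_mulSupport_subset (s := hA.toFinset) f (fun a ha ↦ by
      rw [Set.Finite.coe_toFinset]
      by_contra h
      exact ha (h1 a h)),
    Finset.prod_congr rfl (fun a ha ↦ hz a (hA.mem_toFinset.mp ha)), Finset.prod_const,
    Set.ncard_eq_toFinset_card A hA]

open scoped IsMulCommutative in
/-- The local factors of the invariant of `ρ` formed with `ρt`, and their product. -/
theorem local_factors_of_isTameRealLift (hπ : π.ker ≤ center E) (h2 : Nat.card π.ker = 2)
    (hc : ∀ x ∈ c, orderOf x = 3) (hρ : RamificationOfType ρ c) (hρt : IsTameRealLift π ρ ρt)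
    {P : Nat.Primes → Ideal (𝓞 QBar)} {g : Nat.Primes → GalQ}
    (hPg : ∀ p, IsPrimeAbove (P p) p ∧ IsTameNegOne p (P p) (g p))
    {f : Nat.Primes → center E} (hf : ∀ p, (f p : E) = ρt (g p) ^ 3) {z : E} (hz : π z = 1)
    (hz1 : z ≠ 1) :
    (Function.mulSupport f).Finite ∧ ((∏ᶠ p, f p : center E) : E) =
      z ^ (evenRamifiedThreeModFour (fieldOf ρt)).ncard := by
  let A : Set Nat.Primes := {p | (p : ℕ) ∈ evenRamifiedThreeModFour (fieldOf ρt)}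
  have hfin := finite_evenRamifiedThreeModFour_fieldOf hρt.2.1
  have hA : A.Finite := hfin.preimage Subtype.val_injective.injOn
  have hcard : A.ncard = (evenRamifiedThreeModFour (fieldOf ρt)).ncard :=
    Set.ncard_preimage_of_injective_subset_range Subtype.val_injective fun p hp ↦ ⟨⟨p, hp.1⟩, rfl⟩
  have hiff (p : Nat.Primes) : (f p : E) ≠ 1 ↔ p ∈ A := by
    rw [hf p]
    exact pow_three_ne_one_iff_mem_evenRamifiedThreeModFour hπ h2 hc hρ hρt p.2 (hPg p).1 (hPg p).2
  have h1 (p : Nat.Primes) (hp : p ∉ A) : f p = 1 := by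
    by_contra h
    exact hp ((hiff p).mp fun h' ↦ h (Subtype.ext h'))
  refine ⟨hA.subset fun p hp ↦ by_contra fun h ↦ hp (h1 p h), ?_⟩
  rw [finprod_eq_pow_ncard f A ⟨z, hπ hz⟩ hA h1 fun p hp ↦ Subtype.ext ?_, hcard]
  · rfl
  · refine eq_of_card_ker h2 ?_ hz ((hiff p).mpr hp) hz1
    rw [hf p]
    exact map_pow_three_eq_one hc hρ hρt.1 p.2 (hPg p).1 (hPg p).2.1

/-- A value computed with any lift is a power of `z` counting primes for that lift, and only the
parity of the exponent matters. Conversely, primes, elements and distinguished lifts exist, so the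
value is attained. -/
theorem isInvariant_iff (hs : Set.BijOn π {y : E | orderOf y = 3} c) (hπ : π.ker ≤ center E)
    (h2 : Nat.card π.ker = 2) (hc : ∀ x, x ∈ c ↔ orderOf x = 3) (hρ : RamificationOfType ρ c)
    (hρt : IsTameRealLift π ρ ρt) {z : E} (hz : π z = 1) (hz1 : z ≠ 1) (z' : E) :
    IsInvariant π {y : E | orderOf y = 3} ρ z' ↔
      z' = z ^ (evenRamifiedThreeModFour (fieldOf ρt)).ncard := by
  have hc' : ∀ x ∈ c, orderOf x = 3 := fun x ↦ (hc x).mp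
  constructor
  · rintro ⟨ρt', P, g, s, f, hρt', hPg, hsg, hf, -, rfl⟩
    have hf' (p : Nat.Primes) : (f p : E) = ρt' (g p) ^ 3 := by
      rw [hf p]
      refine mul_inv_eq_pow_three hπ h2 (hsg p).1 ?_
      rw [(hsg p).2]
      exact (DFunLike.congr_fun hρt'.1 (g p)).symm
    rw [(local_factors_of_isTameRealLift hπ h2 hc' hρ hρt' hPg hf' hz hz1).2]
    have h := ncard_evenRamifiedThreeModFour_eq hπ h2 hc' hρ hρt' hρt
    rw [ZMod.natCast_eq_natCast_iff'] at h
    rw [pow_eq_pow_mod _ (sq_eq_one_of_card_ker h2 hz), h,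
      ← pow_eq_pow_mod _ (sq_eq_one_of_card_ker h2 hz)]
  · rintro rfl
    choose P hP using fun p : Nat.Primes ↦ exists_isPrimeAbove p.2
    choose g hg using fun p : Nat.Primes ↦ exists_isTameNegOne p.2 (hP p)
    have hex (p : Nat.Primes) : ∃ s ∈ insert 1 {y : E | orderOf y = 3}, π s = ρ (g p) := by
      by_cases h1 : ρ (g p) = 1
      · exact ⟨1, Set.mem_insert _ _, by rw [map_one, h1]⟩
      · have : Fact (Nat.Prime 3) := ⟨Nat.prime_three⟩
        have h3 := orderOf_eq_prime
          (pow_three_eq_one_of_ramificationOfType hc' hρ p.2 (hP p) (hg p).1) h1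
        obtain ⟨s, hs', hsg⟩ := hs.surjOn ((hc _).mpr h3)
        exact ⟨s, Set.mem_insert_of_mem _ hs', hsg⟩
    choose s hs' hsg using hex
    have hf' (p : Nat.Primes) : ρt (g p) * (s p)⁻¹ = ρt (g p) ^ 3 := by
      refine mul_inv_eq_pow_three hπ h2 (hs' p) ?_
      rw [hsg p]
      exact (DFunLike.congr_fun hρt.1 (g p)).symm
    have hmem (p : Nat.Primes) : ρt (g p) * (s p)⁻¹ ∈ center E := hπ (by
      rw [hf' p]
      exact map_pow_three_eq_one hc' hρ hρt.1 p.2 (hP p) (hg p).1)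
    obtain ⟨h3, h4⟩ := local_factors_of_isTameRealLift hπ h2 hc' hρ hρt
      (fun p ↦ ⟨hP p, hg p⟩) (f := fun p ↦ ⟨_, hmem p⟩) hf' hz hz1
    exact ⟨ρt, P, g, s, fun p ↦ ⟨_, hmem p⟩, hρt, fun p ↦ ⟨hP p, hg p⟩,
      fun p ↦ ⟨hs' p, hsg p⟩, fun p ↦ rfl, h3, h4.symm⟩

end TameLifts

end

theorem mainTheorem3 (n : ℕ) (hn : n = 4 ∨ n = 5) {E : Type*} [Group E]
    (π : E →* alternatingGroup (Fin n))
    (hπ : SchurInvariant.IsReducedSchurCover π (SchurInvariant.threeCycles n)) :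
    Set.BijOn π {y : E | orderOf y = 3} (SchurInvariant.threeCycles n) ∧
    ∃ e : π.ker ≃* Multiplicative (ZMod 2),
      ∀ ρ : SchurInvariant.GalQ →* alternatingGroup (Fin n),
        Function.Surjective ρ → IsOpen (ρ.ker : Set SchurInvariant.GalQ) →
        SchurInvariant.TrivialAtInfinity ρ →
        SchurInvariant.RamificationOfType ρ (SchurInvariant.threeCycles n) →
        ∀ ρt : SchurInvariant.GalQ →* E, SchurInvariant.IsTameRealLift π ρ ρt →
          (SchurInvariant.evenRamifiedThreeModFour (SchurInvariant.fieldOf ρt)).Finite ∧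
          ∃ z : π.ker,
            (∀ z' : E,
              SchurInvariant.IsInvariant π {y : E | orderOf y = 3} ρ z' ↔ z' = (z : E)) ∧
            e z = Multiplicative.ofAdd
              (((SchurInvariant.evenRamifiedThreeModFour
                (SchurInvariant.fieldOf ρt)).ncard : ℕ) : ZMod 2) := by
  obtain ⟨hs, hc, h2⟩ := surjective_and_card_ker_of_isReducedSchurCover hn hπ
  have h3 (x : alternatingGroup (Fin n)) : x ∈ SchurInvariant.threeCycles n ↔ orderOf x = 3 :=
    mem_threeCycles_iff_orderOf_eq_three hn
  have hbij : Set.BijOn π {y : E | orderOf y = 3} (SchurInvariant.threeCycles n) := by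
    rw [show SchurInvariant.threeCycles n = {x | orderOf x = 3} from Set.ext h3]
    exact bijOn_orderOf_eq_three hs hc h2
  have : Fact (Nat.Prime 2) := ⟨Nat.prime_two⟩
  let e : π.ker ≃* Multiplicative (ZMod 2) :=
    mulEquivOfPrimeCardEq (p := 2) h2 (Nat.card_zmod 2)
  refine ⟨hbij, e, fun ρ _ _ _ hρ ρt hρt ↦
    ⟨finite_evenRamifiedThreeModFour_fieldOf hρt.2.1, ?_⟩⟩
  let z := e.symm (Multiplicative.ofAdd 1)
  have hz1 : (z : E) ≠ 1 := fun h ↦ by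
    have : e.symm (Multiplicative.ofAdd 1) = 1 := Subtype.ext h
    rw [map_eq_one_iff e.symm e.symm.injective] at this
    exact one_ne_zero (α := ZMod 2) (ofAdd_eq_one.mp this)
  refine ⟨z ^ (SchurInvariant.evenRamifiedThreeModFour (SchurInvariant.fieldOf ρt)).ncard,
    fun z' ↦ isInvariant_iff hbij hc h2 h3 hρ hρt z.2 hz1 z', ?_⟩
  rw [map_pow, e.apply_symm_apply, ← ofAdd_nsmul, nsmul_one]
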